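/- Throughout, functions are real-valued and 1-periodic on $\mathbb R$. For an integer $k\ge 0$ let $\|f\|_k=\bigl(\sum_{i=0}^{k}\int_0^1|f^{(i)}|^2dx\bigr)^{1/2}$ and $\|f\|_{k,\infty}=\max_{0\le i\le k}\operatorname{ess\,sup}_{(0,1)}|f^{(i)}|$ (weak derivatives of periodic functions), $\|\cdot\|=\|\cdot\|_0$; $H^k_{per}$ is the periodic Sobolev space with norm $\|\cdot\|_k$, and elements of $H^k_{per}$, $k\ge1$, are identified with their continuous representatives. For a positive integer $N$ put $h=1/N$, $x_i=ih$, and for an integer $r\ge 3$ let $$S_h=\{\phi\in C^{r-2}_{per}:\ \phi|_{[x_{i-1},x_i]}\text{ is a polynomial of degree}\le r-1,\ 1\le i\le N\}.$$ By a family of quasiinterpolants of order $r$ we mean the operators $Q_hv=\sum_{j=1}^N v(x_j)\phi_j$, $h=1/N$, $N\ge1$, given by bases $\{\phi_j\}_{j=1}^N=\{\phi_j^{(N)}\}_{j=1}^N$ of $S_h$ such that, with constants $K$, $C$ independent of $N$, $j$ and $v$, the support of $\phi_j$ is contained, modulo 1, in an interval of length at most $Kh$, and $\|Q_hv-v\|\le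 Ch^r\|v^{(r)}\|$ for all $v\in C^\infty_{per}$. **Lemma 2.1.** Let $r\ge 3$. Families of quasiinterpolants of order $r$ exist, and every such family has the following properties. (a) There is a constant $C$ such that for all $v\in H^r_{per}(0,1)\cap W^r_\infty(0,1)$, all $N\ge 1$ and $j=0,1,2$, with $h=1/N$ and $V=Q_hv$, $$\|V-v\|_j\le Ch^{r-j}\|v\|_r,\qquad \|V-v\|_{j,\infty}\le Ch^{r-j-1/2}\|v\|_{r,\infty}.$$ (b) For every $v\in H^r_{per}(0,1)\cap W^r_\infty(0,1)$ there is a constant $C$ independent of $h$ such that $\|V\|_j\le C$ and $\|V\|_{j,\infty}\le C$ for $j=0,1,2$ and all $h=1/N$, $N\ge 1$. (c) If in addition $\min_{0\le x\le 1}v(x)\ge c_0>0$, then there exists $h_0>0$ such that $\min_{0\le x\le 1}V(x)\ge c_0/2$ for all $h=1/N\le h_0$. -/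

import Mathlib

open MeasureTheory
open scoped ENNReal ContDiff

noncomputable section

/-! Functions on the periodic interval are functions `ℝ → ℝ` of period 1; norms and integrals are
taken over one period. The mesh has `N ≥ 1` cells, meshlength `h = 1 / N`, nodes `i / N`. -/

/-- Lebesgue measure on one period. -/
def perMeasure : Measure ℝ := volume.restrict (Set.Ioc (0 : ℝ) 1)

/-- `g` is a weak derivative of order `k` of the 1-periodic function `f`, tested against smooth
1-periodic functions. Such a `g` is unique up to a null set of `(0, 1)`. -/
structure HasPerWeakDeriv (k : ℕ) (f g : ℝ → ℝ) : Prop where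
  integrable_left : Integrable f perMeasure
  integrable_right : Integrable g perMeasure
  integral_eq : ∀ ψ : ℝ → ℝ, ContDiff ℝ ∞ ψ → Function.Periodic ψ 1 →
    ∫ x, f x * iteratedDeriv k ψ x ∂perMeasure = (-1) ^ k * ∫ x, g x * ψ x ∂perMeasure

/-- The norm `‖f‖ₖ = (∑_{i ≤ k} ‖f⁽ⁱ⁾‖²_{L²(0,1)})^{1/2}` with weak derivatives. Weak derivatives
being unique a.e., the infimum is over a single value; it is `∞` if `f` does not have all
weak derivatives up to order `k`. -/
def perHNorm (k : ℕ) (f : ℝ → ℝ) : ℝ≥0∞ :=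
  ⨅ (G : ℕ → ℝ → ℝ) (_ : ∀ i ≤ k, HasPerWeakDeriv i f (G i)),
    (∑ i ∈ Finset.range (k + 1), eLpNorm (G i) 2 perMeasure ^ 2) ^ (1 / 2 : ℝ)

/-- The norm `‖f‖_{k,∞} = max_{i ≤ k} ‖f⁽ⁱ⁾‖_{L^∞(0,1)}` with weak derivatives (`∞` if `f` does not
have all weak derivatives up to order `k`). -/
def perWNorm (k : ℕ) (f : ℝ → ℝ) : ℝ≥0∞ :=
  ⨅ (G : ℕ → ℝ → ℝ) (_ : ∀ i ≤ k, HasPerWeakDeriv i f (G i)),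
    (Finset.range (k + 1)).sup fun i => eLpNorm (G i) ⊤ perMeasure

/-- `v ∈ H^k_per ∩ W^k_∞`, for `k ≥ 1`: `v` is 1-periodic with all weak derivatives up to order `k`
in `L²` and in `L^∞`. As usual `v` stands for its continuous representative, so that its values at
the nodes make sense. -/
structure MemHperWinf (k : ℕ) (v : ℝ → ℝ) : Prop where
  periodic : Function.Periodic v 1
  continuous : Continuous v
  hNorm_lt_top : perHNorm k v < ⊤
  wNorm_lt_top : perWNorm k v < ⊤

/-- The space `S_h`, `h = 1 / N`, of smooth 1-periodic splines of order `r`: functions in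
`C_per^{r-2}` that are polynomials of degree at most `r - 1` on every `[i h, (i + 1) h]`. -/
def splineSpace (r N : ℕ) : Submodule ℝ (ℝ → ℝ) where
  carrier := {φ | Function.Periodic φ 1 ∧ ContDiff ℝ ((r - 2 : ℕ) : ℕ∞) φ ∧
    ∀ i < N, ∃ p ∈ Polynomial.degreeLT ℝ r,
      ∀ x ∈ Set.Icc ((i : ℝ) / N) (((i : ℝ) + 1) / N), φ x = p.eval x}
  zero_mem' := by
    refine ⟨fun _ => rfl, contDiff_const, fun i _ => ⟨0, Submodule.zero_mem _, ?_⟩⟩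
    intro x _
    simp
  add_mem' := by
    rintro f g ⟨hf1, hf2, hf3⟩ ⟨hg1, hg2, hg3⟩
    refine ⟨hf1.add hg1, hf2.add hg2, fun i hi => ?_⟩
    obtain ⟨p, hp, hp'⟩ := hf3 i hi
    obtain ⟨q, hq, hq'⟩ := hg3 i hi
    refine ⟨p + q, Submodule.add_mem _ hp hq, fun x hx => ?_⟩
    simp [hp' x hx, hq' x hx]
  smul_mem' := by
    rintro c f ⟨hf1, hf2, hf3⟩
    refine ⟨fun x => by simp [hf1 x], contDiff_const.smul hf2, fun i hi => ?_⟩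
    obtain ⟨p, hp, hp'⟩ := hf3 i hi
    refine ⟨c • p, Submodule.smul_mem _ c hp, fun x hx => ?_⟩
    simp [hp' x hx]

/-- `Q_h v = ∑_{j=1}^N v(x_j) φ_j` with `x_j = j / N`; the index `j : Fin N` stands for `j + 1`. -/
def quasiInterp {N : ℕ} (φ : Fin N → ℝ → ℝ) (v : ℝ → ℝ) : ℝ → ℝ :=
  fun x => ∑ j : Fin N, v (((j : ℝ) + 1) / N) * φ j x

/-- `φ` assigns to every `h = 1 / N` a basis of `S_h` of functions whose support has, modulo 1,
diameter `O(h)`, such that `∑_j v(x_j) φ_j` is an approximation of optimal order `h^r` in `L²` for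
all smooth 1-periodic `v`: the bases that define quasiinterpolants. -/
structure IsQuasiInterpBasis (r : ℕ) (φ : ∀ N : ℕ, Fin N → ℝ → ℝ) : Prop where
  linearIndependent : ∀ N, 1 ≤ N → LinearIndependent ℝ (φ N)
  span_eq : ∀ N, 1 ≤ N → Submodule.span ℝ (Set.range (φ N)) = splineSpace r N
  support_small : ∃ K : ℝ, ∀ N, 1 ≤ N → ∀ j : Fin N, ∃ a : ℝ, ∀ x, φ N j x ≠ 0 →
    ∃ m : ℤ, |x - m - a| ≤ K * (1 / (N : ℝ))
  optimal_order : ∃ C : ℝ, ∀ N, 1 ≤ N → ∀ v : ℝ → ℝ, Function.Periodic v 1 → ContDiff ℝ ∞ v →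
    eLpNorm (quasiInterp (φ N) v - v) 2 perMeasure ≤
      ENNReal.ofReal (C * (1 / (N : ℝ)) ^ r) * eLpNorm (iteratedDeriv r v) 2 perMeasure

end

/-! Error estimates. On each cell a spline is a polynomial of degree less than `r`, so the `r`-th
derivative of the error against a smooth `v` is `-v⁽ʳ⁾` there. A scaled interpolation inequality
(`sq_iteratedDeriv_le_interval`) bounds every lower derivative of the error pointwise on a cell by
the `L²` norms of the error and of `v⁽ʳ⁾` on that cell. Summing over cells turns the assumed `L²`
order into `h^(r-k)` for the `k`-th derivative in `L²`. Keeping one cell gives the sup norm, with a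
loss of `h^(1/2)` (`exists_smooth_error_bound`).

Nonsmooth `v` are approximated by the partial sums of their Fourier series. Taking partial sums
commutes with weak differentiation, so all derivatives converge in `L²` at once, and the nodal
values converge as well. Lower semicontinuity of the `L^p` norms carries the estimate over to `v`
(`quasiInterp_error_of_smooth`). Part (a) follows by collecting norms, (b) by the triangle
inequality, and (c) because the uniform error tends to zero.

Existence. A mask polynomial `β` divisible by `(X - 1)^r` makes `∑ β_l (x - l)₊^(r-1)` a compactly
supported spline kernel, whose integer translates form the series `∑ c_k B(x - k)`. If the
polynomial of integer samples of the kernel is `1` modulo `(X - 1)^r`, the series with `c_k = q(k)`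
reproduces every polynomial `q` of degree less than `r`. Local Taylor expansion then gives the order
`h^r`. For `β = a (X - 1)^r` the sample polynomial is `a Γ` with `Γ(1) ≠ 0`, so Bézout supplies a
suitable `a`. One real degree of freedom is left, and it is used to keep `a` away from zero at all
roots of unity (`exists_mask`). That makes the periodized kernels independent for every `N`. Since
the spline space has dimension at most `N` (`splineNodal_injective`), they form a basis. -/

/-! ### Taylor polynomials and interpolation inequalities on an interval -/

theorem iteratedDeriv_polynomial_eval (p : Polynomial ℝ) (k : ℕ) :
    iteratedDeriv k (fun x => p.eval x) = fun x => (Polynomial.derivative^[k] p).eval x := by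
  induction k with
  | zero => simp
  | succ k ih =>
    rw [iteratedDeriv_succ, ih, Function.iterate_succ_apply']
    funext x
    exact Polynomial.deriv _

theorem contDiff_polynomial_eval (p : Polynomial ℝ) {n : ℕ∞ω} :
    ContDiff ℝ n (fun x => p.eval x) :=
  by simpa [Polynomial.aeval_def] using p.contDiff_aeval (𝕜 := ℝ) n

theorem iterate_derivative_eq_zero_of_mem_degreeLT {r k : ℕ} {p : Polynomial ℝ}
    (hp : p ∈ Polynomial.degreeLT ℝ r) (hk : r ≤ k) : Polynomial.derivative^[k] p = 0 := by
  by_cases h0 : p = 0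
  · simp [h0]
  · refine Polynomial.iterate_derivative_eq_zero ?_
    rw [Polynomial.mem_degreeLT, Polynomial.degree_eq_natDegree h0] at hp
    exact lt_of_lt_of_le (by exact_mod_cast hp) hk

/-- Existence of the Taylor polynomial. -/
theorem exists_polynomial_iteratedDeriv_eq (c : ℕ → ℝ) (a : ℝ) (r : ℕ) :
    ∃ p ∈ Polynomial.degreeLT ℝ r,
      ∀ k < r, iteratedDeriv k (fun x => p.eval x) a = c k := by
  classical
  set q : Polynomial ℝ := ∑ k ∈ Finset.range r, Polynomial.monomial k (c k / k.factorial) with hq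
  have hqd : q.degree < r := by
    rw [← Polynomial.mem_degreeLT, hq]
    refine Submodule.sum_mem _ fun k hk => Polynomial.mem_degreeLT.2 ?_
    refine (Polynomial.degree_monomial_le _ _).trans_lt ?_
    exact_mod_cast Finset.mem_range.1 hk
  refine ⟨Polynomial.taylor (-a) q, ?_, fun k hk => ?_⟩
  · rw [Polynomial.mem_degreeLT, Polynomial.degree_taylor]
    exact hqd
  · rw [iteratedDeriv_polynomial_eval]
    have h1 : (Polynomial.taylor a (Polynomial.taylor (-a) q)).coeff k = c k / k.factorial := by
      rw [Polynomial.taylor_taylor]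
      simp [hq, Polynomial.finsetSum_coeff, Polynomial.coeff_monomial, hk]
    rw [Polynomial.taylor_coeff] at h1
    have h2 := congrFun (Polynomial.factorial_smul_hasseDeriv (R := ℝ) k) (Polynomial.taylor (-a) q)
    simp only [← h2, LinearMap.smul_apply, Polynomial.eval_smul] at *
    rw [h1]
    have : (k.factorial : ℝ) ≠ 0 := by positivity
    simp [nsmul_eq_mul]
    field_simp

theorem hasDerivAt_iteratedDeriv {w : ℝ → ℝ} (hw : ContDiff ℝ ∞ w) (k : ℕ) (x : ℝ) :
    HasDerivAt (iteratedDeriv k w) (iteratedDeriv (k + 1) w x) x := by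
  rw [iteratedDeriv_succ]
  exact ((hw.differentiable_iteratedDeriv k (by exact_mod_cast WithTop.coe_lt_top _)) x).hasDerivAt

theorem continuous_iteratedDeriv_of_smooth {w : ℝ → ℝ} (hw : ContDiff ℝ ∞ w) (k : ℕ) :
    Continuous (iteratedDeriv k w) :=
  hw.continuous_iteratedDeriv k (by exact_mod_cast le_top)

/-- Integrating from the common zero `a` lowers the order of the derivative by one. The first
integration produces the integral of `|w⁽ʳ⁾|`; each of the following `m` costs a factor `β - α`. -/
theorem abs_iteratedDeriv_le_of_vanishing {w : ℝ → ℝ} (hw : ContDiff ℝ ∞ w) {r : ℕ}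
    {a α β : ℝ} (ha : a ∈ Set.Icc α β) (h0 : ∀ k < r, iteratedDeriv k w a = 0) :
    ∀ m < r, ∀ y ∈ Set.Icc α β,
      |iteratedDeriv (r - 1 - m) w y| ≤
        (β - α) ^ m * ∫ t in α..β, |iteratedDeriv r w t| := by
  have hab : α ≤ β := ha.1.trans ha.2
  have ftc : ∀ k y, k < r → iteratedDeriv k w y = ∫ t in a..y, iteratedDeriv (k + 1) w t := by
    intro k y hk
    rw [intervalIntegral.integral_eq_sub_of_hasDerivAt
      (fun x _ => hasDerivAt_iteratedDeriv hw k x)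
      ((continuous_iteratedDeriv_of_smooth hw _).intervalIntegrable _ _), h0 k hk, sub_zero]
  intro m
  induction m with
  | zero =>
    intro hr y hy
    rw [Nat.sub_zero, ftc _ _ (by omega), Nat.sub_add_cancel (by omega), pow_zero, one_mul]
    have hi : Continuous fun t => |iteratedDeriv r w t| :=
      (continuous_iteratedDeriv_of_smooth hw r).abs
    rw [intervalIntegral.integral_of_le hab]
    refine (intervalIntegral.norm_integral_le_integral_norm_uIoc
      (f := iteratedDeriv r w) (μ := volume) (a := a) (b := y)).trans ?_
    refine setIntegral_mono_set (hi.integrableOn_Icc.mono_set Set.Ioc_subset_Icc_self)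
      (Filter.Eventually.of_forall fun x => abs_nonneg _) ?_
    exact (Set.Ioc_subset_Ioc (le_min ha.1 hy.1) (max_le ha.2 hy.2)).eventuallyLE
  | succ m ih =>
    intro hr y hy
    rw [ftc _ _ (by omega), show r - 1 - (m + 1) + 1 = r - 1 - m by omega]
    set B := (β - α) ^ m * ∫ t in α..β, |iteratedDeriv r w t| with hB
    have hsub : ∀ t ∈ Set.uIoc a y, ‖iteratedDeriv (r - 1 - m) w t‖ ≤ B := by
      intro t ht
      refine ih (by omega) t ?_
      have := Set.uIoc_subset_uIcc ht
      exact Set.uIcc_subset_Icc ha hy this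
    refine (intervalIntegral.norm_integral_le_of_norm_le_const hsub).trans ?_
    have hB0 : 0 ≤ B := mul_nonneg (pow_nonneg (by linarith) _)
      (intervalIntegral.integral_nonneg hab fun _ _ => abs_nonneg _)
    have : |y - a| ≤ β - α := by
      rw [abs_le]; constructor <;> linarith [ha.1, ha.2, hy.1, hy.2]
    calc B * |y - a| ≤ B * (β - α) := by gcongr
      _ = _ := by rw [hB]; ring

/-- Cauchy–Schwarz against the constant `1`, read off from the nonnegative variance of `|f|`. -/
theorem sq_integral_abs_le {f : ℝ → ℝ} (hf : Continuous f) {α β : ℝ} (hab : α ≤ β) :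
    (∫ t in α..β, |f t|) ^ 2 ≤ (β - α) * ∫ t in α..β, f t ^ 2 := by
  rcases hab.eq_or_lt with rfl | hlt
  · simp
  set I := ∫ t in α..β, |f t| with hI
  have hL : 0 < β - α := by linarith
  have h := intervalIntegral.integral_nonneg (μ := volume)
    (f := fun t => (|f t| - I / (β - α)) ^ 2) hab fun t _ => sq_nonneg _
  have hi1 : IntervalIntegrable (fun t => f t ^ 2) volume α β := (hf.pow 2).intervalIntegrable _ _
  have hi2 : IntervalIntegrable (fun t => (2 * (I / (β - α))) * |f t|) volume α β :=
    (hf.abs.const_mul _).intervalIntegrable _ _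
  have e : ∀ t, (|f t| - I / (β - α)) ^ 2
      = f t ^ 2 - (2 * (I / (β - α))) * |f t| + (I / (β - α)) ^ 2 := by
    intro t; rw [← sq_abs (f t)]; ring
  simp_rw [e] at h
  rw [intervalIntegral.integral_add (hi1.sub hi2) (by simp),
    intervalIntegral.integral_sub hi1 hi2, intervalIntegral.integral_const_mul, ← hI,
    intervalIntegral.integral_const, smul_eq_mul] at h
  have : I ^ 2 / (β - α) ≤ ∫ t in α..β, f t ^ 2 := by
    have e2 : 2 * (I / (β - α)) * I - (β - α) * (I / (β - α)) ^ 2 = I ^ 2 / (β - α) := by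
      field_simp; ring
    linarith
  rw [div_le_iff₀ hL] at this
  linarith

theorem sq_iteratedDeriv_le_of_vanishing {w : ℝ → ℝ} (hw : ContDiff ℝ ∞ w) {r : ℕ}
    {a α β : ℝ} (ha : a ∈ Set.Icc α β) (h0 : ∀ k < r, iteratedDeriv k w a = 0)
    {k : ℕ} (hk : k < r) {y : ℝ} (hy : y ∈ Set.Icc α β) :
    iteratedDeriv k w y ^ 2 ≤
      (β - α) ^ (2 * (r - 1 - k) + 1) * ∫ t in α..β, iteratedDeriv r w t ^ 2 := by
  have h1 := abs_iteratedDeriv_le_of_vanishing hw ha h0 (r - 1 - k) (by omega) y hy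
  rw [show r - 1 - (r - 1 - k) = k by omega] at h1
  have hab : α ≤ β := ha.1.trans ha.2
  calc iteratedDeriv k w y ^ 2 = |iteratedDeriv k w y| ^ 2 := (sq_abs _).symm
    _ ≤ ((β - α) ^ (r - 1 - k) * ∫ t in α..β, |iteratedDeriv r w t|) ^ 2 := by gcongr
    _ = (β - α) ^ (2 * (r - 1 - k)) * (∫ t in α..β, |iteratedDeriv r w t|) ^ 2 := by ring
    _ ≤ (β - α) ^ (2 * (r - 1 - k)) * ((β - α) * ∫ t in α..β, iteratedDeriv r w t ^ 2) := by
        gcongr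
        exact sq_integral_abs_le (continuous_iteratedDeriv_of_smooth hw r) hab
    _ = _ := by ring

theorem polynomial_eq_zero_of_eqOn_Icc {p : Polynomial ℝ} {α β : ℝ} (hab : α < β)
    (h : ∀ x ∈ Set.Icc α β, p.eval x = 0) : p = 0 :=
  Polynomial.eq_zero_of_infinite_isRoot p ((Set.Icc_infinite hab).mono fun x hx => h x hx)

theorem polynomial_eq_of_eqOn_Icc {p q : Polynomial ℝ} {α β : ℝ} (hab : α < β)
    (h : ∀ x ∈ Set.Icc α β, p.eval x = q.eval x) : p = q :=
  sub_eq_zero.1 (polynomial_eq_zero_of_eqOn_Icc hab fun x hx => by simp [h x hx])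

/-- The `L²(0, 1)` inner product on the polynomials of degree less than `r`. -/
noncomputable abbrev polyInnerCore (r : ℕ) :
    InnerProductSpace.Core ℝ (Polynomial.degreeLT ℝ r) where
  inner p q := ∫ t in (0 : ℝ)..1, (p : Polynomial ℝ).eval t * (q : Polynomial ℝ).eval t
  conj_inner_symm p q := by simp [mul_comm]
  re_inner_nonneg p :=
    intervalIntegral.integral_nonneg zero_le_one fun t _ => mul_self_nonneg _
  add_left p q s := by
    simp only [Submodule.coe_add, Polynomial.eval_add, add_mul]
    refine intervalIntegral.integral_add ?_ ?_ <;>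
      exact Continuous.intervalIntegrable (by fun_prop) _ _
  smul_left p q c := by
    simp [mul_assoc]
  definite p hp := by
    have hp' : ∫ t in (0 : ℝ)..1, (p : Polynomial ℝ).eval t * (p : Polynomial ℝ).eval t = 0 := hp
    have hc : Continuous fun t => (p : Polynomial ℝ).eval t * (p : Polynomial ℝ).eval t := by
      fun_prop
    have h0 : ∀ x ∈ Set.Icc (0 : ℝ) 1, (p : Polynomial ℝ).eval x = 0 := by
      by_contra! hne
      obtain ⟨x, hx, hx0⟩ := hne
      have := intervalIntegral.integral_pos zero_lt_one hc.continuousOn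
        (fun t _ => mul_self_nonneg _) ⟨x, hx, mul_self_pos.2 hx0⟩
      linarith
    exact Subtype.ext (polynomial_eq_zero_of_eqOn_Icc zero_lt_one h0)

/-- The polynomials of degree less than `r` form a finite-dimensional space, so `p ↦ p⁽ᵏ⁾` is
continuous from the `L²` norm to the sup norm. The constant is the squared operator norm. -/
theorem sq_polynomial_deriv_le_integral (r k : ℕ) :
    ∃ C : ℝ, 0 ≤ C ∧ ∀ p ∈ Polynomial.degreeLT ℝ r, ∀ t ∈ Set.Icc (0 : ℝ) 1,
      (Polynomial.derivative^[k] p).eval t ^ 2 ≤ C * ∫ s in (0 : ℝ)..1, p.eval s ^ 2 := by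
  let := (polyInnerCore r).toNormedAddCommGroup
  let : InnerProductSpace ℝ (Polynomial.degreeLT ℝ r) := .ofCore (polyInnerCore r).toCore
  let T : Polynomial.degreeLT ℝ r →ₗ[ℝ] C(Set.Icc (0 : ℝ) 1, ℝ) :=
    { toFun := fun p => ⟨fun t => (Polynomial.derivative^[k] (p : Polynomial ℝ)).eval (t : ℝ),
        by fun_prop⟩
      map_add' := fun p q => by ext t; simp [iterate_map_add]
      map_smul' := fun c p => by ext t; simp [Polynomial.iterate_derivative_smul] }
  have : FiniteDimensional ℝ (Polynomial.degreeLT ℝ r) :=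
    Module.Finite.equiv (Polynomial.degreeLTEquiv ℝ r).symm
  let T' := LinearMap.toContinuousLinearMap T
  refine ⟨‖T'‖ ^ 2, by positivity, fun p hp t ht => ?_⟩
  have h1 : ‖T' ⟨p, hp⟩ ⟨t, ht⟩‖ ≤ ‖T'‖ * ‖(⟨p, hp⟩ : Polynomial.degreeLT ℝ r)‖ :=
    ((T' ⟨p, hp⟩).norm_coe_le_norm _).trans (T'.le_opNorm _)
  have h2 : ‖(⟨p, hp⟩ : Polynomial.degreeLT ℝ r)‖ ^ 2 = ∫ s in (0 : ℝ)..1, p.eval s ^ 2 := by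
    rw [← real_inner_self_eq_norm_sq]
    simp only [sq]
    rfl
  rw [← h2, ← mul_pow, ← sq_abs]
  exact pow_le_pow_left₀ (abs_nonneg _) h1 2

theorem iteratedDeriv_sub_of_smooth {f g : ℝ → ℝ} (hf : ContDiff ℝ ∞ f) (hg : ContDiff ℝ ∞ g)
    (k : ℕ) (x : ℝ) : iteratedDeriv k (fun y => f y - g y) x
      = iteratedDeriv k f x - iteratedDeriv k g x :=
  iteratedDeriv_sub (hf.contDiffAt.of_le (by exact_mod_cast le_top))
    (hg.contDiffAt.of_le (by exact_mod_cast le_top))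

/-- An interpolation inequality of Gagliardo–Nirenberg type on the unit interval. -/
theorem sq_iteratedDeriv_le_unit (r k : ℕ) (hk : k < r) :
    ∃ C : ℝ, 0 ≤ C ∧ ∀ u : ℝ → ℝ, ContDiff ℝ ∞ u → ∀ t ∈ Set.Icc (0 : ℝ) 1,
      iteratedDeriv k u t ^ 2 ≤
        C * ((∫ s in (0 : ℝ)..1, u s ^ 2) + ∫ s in (0 : ℝ)..1, iteratedDeriv r u s ^ 2) := by
  obtain ⟨C, hC0, hC⟩ := sq_polynomial_deriv_le_integral r k
  refine ⟨4 * C + 2, by linarith, fun u hu t ht => ?_⟩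
  -- Split `u = w + p` with `p` the Taylor polynomial at `0`. The remainder `w` is controlled by
  -- `u⁽ʳ⁾` alone, and the `L²` norm of `p = u - w` by those of `u` and `u⁽ʳ⁾`.
  obtain ⟨p, hp, hpa⟩ := exists_polynomial_iteratedDeriv_eq (fun k => iteratedDeriv k u 0) 0 r
  have hps : ContDiff ℝ ∞ fun x => p.eval x := contDiff_polynomial_eval p
  set w : ℝ → ℝ := fun x => u x - p.eval x with hwdef
  have hw : ContDiff ℝ ∞ w := hu.sub hps
  have hwk : ∀ k x, iteratedDeriv k w x
      = iteratedDeriv k u x - (Polynomial.derivative^[k] p).eval x := by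
    intro k x
    rw [hwdef, iteratedDeriv_sub_of_smooth hu hps, iteratedDeriv_polynomial_eval]
  have hwr : ∀ x, iteratedDeriv r w x = iteratedDeriv r u x := by
    intro x
    rw [hwk, iterate_derivative_eq_zero_of_mem_degreeLT hp le_rfl]; simp
  have h0 : ∀ j < r, iteratedDeriv j w 0 = 0 := by
    intro j hj
    rw [hwdef, iteratedDeriv_sub_of_smooth hu hps, hpa j hj, sub_self]
  set J := ∫ s in (0 : ℝ)..1, iteratedDeriv r u s ^ 2 with hJ
  have hwb : ∀ j < r, ∀ y ∈ Set.Icc (0 : ℝ) 1, iteratedDeriv j w y ^ 2 ≤ J := by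
    intro j hj y hy
    have := sq_iteratedDeriv_le_of_vanishing hw (a := 0) (α := 0) (β := 1) (by simp) h0 hj hy
    simpa [hwr] using this
  set I := ∫ s in (0 : ℝ)..1, u s ^ 2 with hI
  have hIp : ∫ s in (0 : ℝ)..1, p.eval s ^ 2 ≤ 2 * I + 2 * J := by
    calc ∫ s in (0 : ℝ)..1, p.eval s ^ 2
        ≤ ∫ s in (0 : ℝ)..1, (2 * u s ^ 2 + 2 * J) := by
          refine intervalIntegral.integral_mono_on zero_le_one
            (Continuous.intervalIntegrable (by fun_prop) _ _)
            (Continuous.intervalIntegrable (by have := hu.continuous; fun_prop) _ _) ?_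
          intro s hs
          have := hwb 0 (by omega) s hs
          simp only [iteratedDeriv_zero, hwdef] at this
          nlinarith [sq_nonneg (u s + (u s - p.eval s))]
      _ = 2 * I + 2 * J := by
          rw [intervalIntegral.integral_add
            (Continuous.intervalIntegrable (by have := hu.continuous; fun_prop) _ _)
            (by simp), intervalIntegral.integral_const_mul]
          simp [hI]
  have h1 := hC p hp t ht
  have h2 := hwb k hk t ht
  rw [hwk] at h2
  have hI0 : 0 ≤ I := intervalIntegral.integral_nonneg zero_le_one fun _ _ => sq_nonneg _
  have h3 := mul_le_mul_of_nonneg_left hIp hC0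
  nlinarith [sq_nonneg (iteratedDeriv k u t - 2 * (Polynomial.derivative^[k] p).eval t)]

/-- The interpolation inequality on an interval of length `h`, with its scaling. -/
theorem sq_iteratedDeriv_le_interval (r k : ℕ) (hk : k < r) :
    ∃ C : ℝ, 0 ≤ C ∧ ∀ u : ℝ → ℝ, ContDiff ℝ ∞ u → ∀ a h : ℝ, 0 < h →
      ∀ x ∈ Set.Icc a (a + h),
      h ^ (2 * k + 1) * iteratedDeriv k u x ^ 2 ≤
        C * ((∫ s in a..(a + h), u s ^ 2) +
          h ^ (2 * r) * ∫ s in a..(a + h), iteratedDeriv r u s ^ 2) := by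
  obtain ⟨C, hC0, hC⟩ := sq_iteratedDeriv_le_unit r k hk
  refine ⟨C, hC0, fun u hu a h hh x hx => ?_⟩
  -- Rescaling to the unit interval: a derivative brings a factor `h` and the integral a factor `1 /
  -- h`, whence the exponents `2k + 1` and `2r`.
  set v : ℝ → ℝ := fun t => u (a + h * t) with hv
  have hvs : ContDiff ℝ ∞ v := hu.comp (by fun_prop)
  have hvk : ∀ j t, iteratedDeriv j v t = h ^ j * iteratedDeriv j u (a + h * t) := by
    intro j t
    have hs : ContDiff ℝ j (fun y => u (a + y)) :=
      (hu.comp (by fun_prop)).of_le (by exact_mod_cast le_top)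
    have h1 := congrFun (iteratedDeriv_comp_const_mul hs h) t
    simp only [hv]
    rw [h1, iteratedDeriv_comp_const_add]
  have h1 := hC v hvs ((x - a) / h) ⟨div_nonneg (by linarith [hx.1]) hh.le,
    (div_le_one hh).2 (by linarith [hx.2])⟩
  have hint : ∀ f : ℝ → ℝ, h * ∫ s in (0 : ℝ)..1, f (a + h * s) = ∫ s in a..(a + h), f s := by
    intro f
    simp
  have hx' : a + h * ((x - a) / h) = x := by field_simp; ring
  rw [hvk, hx'] at h1
  simp_rw [hvk] at h1
  have e1 := hint fun s => u s ^ 2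
  have e2 := hint fun s => iteratedDeriv r u s ^ 2
  simp_rw [mul_pow] at h1
  rw [intervalIntegral.integral_const_mul] at h1
  rw [← e1, ← e2]
  calc h ^ (2 * k + 1) * iteratedDeriv k u x ^ 2
      = h * ((h ^ k) ^ 2 * iteratedDeriv k u x ^ 2) := by ring
    _ ≤ h * (C * ((∫ s in (0 : ℝ)..1, u (a + h * s) ^ 2)
          + (h ^ r) ^ 2 * ∫ s in (0 : ℝ)..1, iteratedDeriv r u (a + h * s) ^ 2)) := by
        gcongr
    _ = _ := by ring

/-! ### One period and its decomposition into mesh cells -/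

instance isProbabilityMeasure_perMeasure : IsProbabilityMeasure perMeasure :=
  ⟨by simp [perMeasure]⟩

theorem integral_perMeasure (f : ℝ → ℝ) : ∫ x, f x ∂perMeasure = ∫ x in (0 : ℝ)..1, f x := by
  rw [intervalIntegral.integral_of_le zero_le_one, perMeasure]

/-- The nodes of the mesh. -/
theorem countable_nodes (N : ℕ) : (Set.range fun i : ℕ => (i : ℝ) / N).Countable :=
  Set.countable_range _

theorem exists_cell {N : ℕ} (hN : 1 ≤ N) {x : ℝ} (hx : x ∈ Set.Ioo (0 : ℝ) 1)
    (hx' : x ∉ Set.range fun i : ℕ => (i : ℝ) / N) :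
    ∃ i < N, x ∈ Set.Ioo ((i : ℝ) / N) (((i : ℝ) + 1) / N) := by
  have hN0 : (0 : ℝ) < N := by exact_mod_cast hN
  have h0 : 0 ≤ x * N := mul_nonneg hx.1.le hN0.le
  refine ⟨⌊x * N⌋₊, ?_, ?_, ?_⟩
  · rw [Nat.floor_lt h0]
    nlinarith [hx.2]
  · refine lt_of_le_of_ne ?_ fun h => hx' ⟨_, h⟩
    rw [div_le_iff₀ hN0]
    exact Nat.floor_le h0
  · rw [lt_div_iff₀ hN0]
    exact Nat.lt_floor_add_one _

theorem ae_exists_cell {N : ℕ} (hN : 1 ≤ N) :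
    ∀ᵐ x ∂perMeasure, ∃ i < N, x ∈ Set.Ioo ((i : ℝ) / N) (((i : ℝ) + 1) / N) := by
  rw [perMeasure, ← restrict_Ioo_eq_restrict_Ioc]
  have h1 : ∀ᵐ x ∂(volume.restrict (Set.Ioo (0 : ℝ) 1)),
      x ∉ Set.range fun i : ℕ => (i : ℝ) / N :=
    ae_restrict_of_ae ((countable_nodes N).ae_notMem volume)
  filter_upwards [h1, ae_restrict_mem measurableSet_Ioo] with x hx1 hx2
  exact exists_cell hN hx2 hx1

theorem cell_lt {N : ℕ} (hN : 1 ≤ N) (i : ℕ) : (i : ℝ) / N < ((i : ℝ) + 1) / N := by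
  have hN0 : (0 : ℝ) < N := by exact_mod_cast hN
  exact div_lt_div_of_pos_right (by linarith) hN0

theorem sum_integral_cells {N : ℕ} (hN : 1 ≤ N) {f : ℝ → ℝ} (hf : Continuous f) :
    ∑ i ∈ Finset.range N, ∫ x in ((i : ℝ) / N)..(((i : ℝ) + 1) / N), f x
      = ∫ x in (0 : ℝ)..1, f x := by
  have hN0 : (N : ℝ) ≠ 0 := by positivity
  have := intervalIntegral.sum_integral_adjacent_intervals (f := f) (μ := volume) (n := N)
    (a := fun i : ℕ => (i : ℝ) / N) fun k _ => hf.intervalIntegrable _ _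
  simpa [hN0] using this

theorem lintegral_perMeasure_eq_sum {N : ℕ} (hN : 1 ≤ N) (f : ℝ → ℝ≥0∞) :
    ∫⁻ x, f x ∂perMeasure
      = ∑ i ∈ Finset.range N, ∫⁻ x in Set.Ioc ((i : ℝ) / N) (((i : ℝ) + 1) / N), f x := by
  have hN0 : (0 : ℝ) < N := by exact_mod_cast hN
  have key : ∀ n : ℕ, ∫⁻ x in Set.Ioc (0 : ℝ) ((n : ℝ) / N), f x
      = ∑ i ∈ Finset.range n, ∫⁻ x in Set.Ioc ((i : ℝ) / N) (((i : ℝ) + 1) / N), f x := by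
    intro n
    induction n with
    | zero => simp
    | succ n ih =>
      have h1 : (0 : ℝ) ≤ (n : ℝ) / N := by positivity
      rw [Finset.sum_range_succ, ← ih, ← lintegral_union measurableSet_Ioc
        (Set.Ioc_disjoint_Ioc_of_le le_rfl), Set.Ioc_union_Ioc_eq_Ioc h1 (cell_lt hN n).le]
      push_cast
      rfl
  rw [← key, div_self hN0.ne', perMeasure]

/-! ### Splines: weak derivatives and dimension -/

section Spline

variable {r N : ℕ} {s : ℝ → ℝ}

theorem spline_iteratedDeriv_eq {i k : ℕ} {p : Polynomial ℝ}
    (hp : ∀ x ∈ Set.Icc ((i : ℝ) / N) (((i : ℝ) + 1) / N), s x = p.eval x) {x : ℝ}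
    (hx : x ∈ Set.Ioo ((i : ℝ) / N) (((i : ℝ) + 1) / N)) :
    iteratedDeriv k s x = (Polynomial.derivative^[k] p).eval x := by
  have h : s =ᶠ[nhds x] fun y => p.eval y := by
    filter_upwards [isOpen_Ioo.mem_nhds hx] with y hy
    exact hp y (Set.Ioo_subset_Icc_self hy)
  rw [h.iteratedDeriv_eq, iteratedDeriv_polynomial_eval]

theorem spline_contDiffAt {i : ℕ} {p : Polynomial ℝ}
    (hp : ∀ x ∈ Set.Icc ((i : ℝ) / N) (((i : ℝ) + 1) / N), s x = p.eval x) {x : ℝ}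
    (hx : x ∈ Set.Ioo ((i : ℝ) / N) (((i : ℝ) + 1) / N)) : ContDiffAt ℝ ∞ s x := by
  have h : s =ᶠ[nhds x] fun y => p.eval y := by
    filter_upwards [isOpen_Ioo.mem_nhds hx] with y hy
    exact hp y (Set.Ioo_subset_Icc_self hy)
  exact (contDiff_polynomial_eval p).contDiffAt.congr_of_eventuallyEq h

theorem spline_hasDerivAt {i k : ℕ} {p : Polynomial ℝ}
    (hp : ∀ x ∈ Set.Icc ((i : ℝ) / N) (((i : ℝ) + 1) / N), s x = p.eval x) {x : ℝ}
    (hx : x ∈ Set.Ioo ((i : ℝ) / N) (((i : ℝ) + 1) / N)) :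
    HasDerivAt (iteratedDeriv k s) (iteratedDeriv (k + 1) s x) x := by
  rw [spline_iteratedDeriv_eq hp hx, Function.iterate_succ_apply']
  have h : iteratedDeriv k s =ᶠ[nhds x] fun y => (Polynomial.derivative^[k] p).eval y := by
    filter_upwards [isOpen_Ioo.mem_nhds hx] with y hy
    exact spline_iteratedDeriv_eq hp hy
  exact (Polynomial.hasDerivAt _ _).congr_of_eventuallyEq h

theorem continuous_iteratedDeriv_spline (hs : s ∈ splineSpace r N) {k : ℕ} (hk : k ≤ r - 2) :
    Continuous (iteratedDeriv k s) :=
  hs.2.1.continuous_iteratedDeriv k (by exact_mod_cast hk)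

theorem continuous_spline (hs : s ∈ splineSpace r N) : Continuous s := hs.2.1.continuous

theorem spline_iteratedDeriv_eq_closed (hN : 1 ≤ N) (hs : s ∈ splineSpace r N) {i k : ℕ}
    (hk : k ≤ r - 2) {p : Polynomial ℝ}
    (hp : ∀ x ∈ Set.Icc ((i : ℝ) / N) (((i : ℝ) + 1) / N), s x = p.eval x) {x : ℝ}
    (hx : x ∈ Set.Icc ((i : ℝ) / N) (((i : ℝ) + 1) / N)) :
    iteratedDeriv k s x = (Polynomial.derivative^[k] p).eval x := by
  have hcl : Set.EqOn (iteratedDeriv k s) (fun y => (Polynomial.derivative^[k] p).eval y)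
      (closure (Set.Ioo ((i : ℝ) / N) (((i : ℝ) + 1) / N))) :=
    Set.EqOn.closure (fun y hy => spline_iteratedDeriv_eq hp hy)
      (continuous_iteratedDeriv_spline hs hk) (by fun_prop)
  rw [closure_Ioo (cell_lt hN i).ne] at hcl
  exact hcl hx

theorem periodic_iteratedDeriv {f : ℝ → ℝ} (hf : Function.Periodic f 1) (k : ℕ) :
    Function.Periodic (iteratedDeriv k f) 1 := by
  intro x
  have h : (fun y => f (y + 1)) = f := funext hf
  conv_rhs => rw [← h]
  rw [iteratedDeriv_comp_add_const]

theorem exists_bound_iteratedDeriv_spline (hs : s ∈ splineSpace r N) (k : ℕ) :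
    ∃ B : ℝ, ∀ i < N, ∀ x ∈ Set.Ioo ((i : ℝ) / N) (((i : ℝ) + 1) / N),
      |iteratedDeriv k s x| ≤ B := by
  have h1 : ∀ i : ℕ, ∃ B : ℝ, 0 ≤ B ∧ (i < N →
      ∀ x ∈ Set.Ioo ((i : ℝ) / N) (((i : ℝ) + 1) / N), |iteratedDeriv k s x| ≤ B) := by
    intro i
    by_cases hi : i < N
    · obtain ⟨p, -, hp⟩ := hs.2.2 i hi
      obtain ⟨B, hB⟩ := (isCompact_Icc (a := (i : ℝ) / N)
        (b := ((i : ℝ) + 1) / N)).exists_bound_of_continuousOn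
        (f := fun y => (Polynomial.derivative^[k] p).eval y) (Continuous.continuousOn (by fun_prop))
      refine ⟨max B 0, le_max_right _ _, fun _ x hx => ?_⟩
      rw [spline_iteratedDeriv_eq hp hx]
      exact (hB x (Set.Ioo_subset_Icc_self hx)).trans (le_max_left _ _)
    · exact ⟨0, le_rfl, fun h => absurd h hi⟩
  choose B hB0 hB using h1
  refine ⟨∑ i ∈ Finset.range N, B i, fun i hi x hx => (hB i hi x hx).trans ?_⟩
  exact Finset.single_le_sum (fun j _ => hB0 j) (Finset.mem_range.2 hi)

theorem memLp_iteratedDeriv_spline (hN : 1 ≤ N) (hs : s ∈ splineSpace r N) (k : ℕ)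
    (q : ℝ≥0∞) : MemLp (iteratedDeriv k s) q perMeasure := by
  obtain ⟨B, hB⟩ := exists_bound_iteratedDeriv_spline hs k
  have hm : AEStronglyMeasurable (iteratedDeriv k s) perMeasure := by
    cases k with
    | zero => rw [iteratedDeriv_zero]; exact (continuous_spline hs).aestronglyMeasurable
    | succ k => rw [iteratedDeriv_succ]; exact (measurable_deriv _).aestronglyMeasurable
  refine MemLp.of_bound hm B ?_
  filter_upwards [ae_exists_cell hN] with x hx
  obtain ⟨i, hi, hx⟩ := hx
  exact hB i hi x hx

/-- A continuous function may fail to be differentiable on a countable set without affecting the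
fundamental theorem of calculus. The boundary terms cancel by periodicity. -/
theorem periodic_integral_by_parts {f f' ψ : ℝ → ℝ} {S : Set ℝ} (hS : S.Countable)
    (hf : Continuous f) (hfp : Function.Periodic f 1)
    (hd : ∀ x ∈ Set.Ioo (0 : ℝ) 1 \ S, HasDerivAt f (f' x) x)
    (hf' : Integrable f' perMeasure) (hψ : ContDiff ℝ ∞ ψ) (hψp : Function.Periodic ψ 1) :
    ∫ x, f x * deriv ψ x ∂perMeasure = - ∫ x, f' x * ψ x ∂perMeasure := by
  have hψd : Differentiable ℝ ψ := hψ.differentiable (by simp)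
  have hψ' : Continuous (deriv ψ) := hψ.continuous_deriv (by simp)
  have hi' : IntervalIntegrable f' volume 0 1 := by
    rwa [intervalIntegrable_iff_integrableOn_Ioc_of_le zero_le_one]
  have h1 : IntervalIntegrable (fun x => f' x * ψ x) volume 0 1 :=
    hi'.mul_continuousOn hψ.continuous.continuousOn
  have h2 : IntervalIntegrable (fun x => f x * deriv ψ x) volume 0 1 :=
    (hf.mul hψ').intervalIntegrable _ _
  have h := MeasureTheory.integral_eq_of_hasDerivAt_off_countable_of_le
    (fun x => f x * ψ x) (fun x => f' x * ψ x + f x * deriv ψ x) zero_le_one hS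
    (hf.mul hψ.continuous).continuousOn
    (fun x hx => (hd x hx).mul (hψd x).hasDerivAt) (h1.add h2)
  rw [intervalIntegral.integral_add h1 h2] at h
  have hf1 : f 1 = f 0 := by simpa using hfp 0
  have hψ1 : ψ 1 = ψ 0 := by simpa using hψp 0
  rw [hf1, hψ1, sub_self] at h
  rw [integral_perMeasure, integral_perMeasure]
  linarith

/-- Passing from order `k` to `k + 1` only needs continuity of the `k`-th derivative. Hence order `r
- 1` is reached, one beyond the classical smoothness of the spline. -/
theorem hasPerWeakDeriv_spline (hr : 2 ≤ r) (hN : 1 ≤ N) (hs : s ∈ splineSpace r N) {k : ℕ}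
    (hk : k + 1 ≤ r) : HasPerWeakDeriv k s (iteratedDeriv k s) := by
  have hint : ∀ j, Integrable (iteratedDeriv j s) perMeasure := fun j =>
    (memLp_iteratedDeriv_spline hN hs j 1).integrable le_rfl
  refine ⟨by simpa using hint 0, hint k, ?_⟩
  induction k with
  | zero => intro ψ _ _; simp
  | succ k ih =>
    intro ψ hψ hψp
    have hψ' : ContDiff ℝ ∞ (deriv ψ) := by
      have := hψ.iterate_deriv 1
      simpa using this
    have hψp' : Function.Periodic (deriv ψ) 1 := by
      have := periodic_iteratedDeriv hψp 1
      rwa [iteratedDeriv_one] at this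
    rw [iteratedDeriv_succ', ih (by omega) _ hψ' hψp',
      periodic_integral_by_parts (countable_nodes N)
        (continuous_iteratedDeriv_spline hs (k := k) (by omega))
        (periodic_iteratedDeriv hs.1 k) (f' := iteratedDeriv (k + 1) s) ?_ (hint _) hψ hψp]
    · ring
    · rintro x ⟨hx, hx'⟩
      obtain ⟨i, hi, hxi⟩ := exists_cell hN hx hx'
      obtain ⟨p, -, hp⟩ := hs.2.2 i hi
      exact spline_hasDerivAt hp hxi

/-- The derivative one order below is affine and periodic, hence constant; descend. -/
theorem eq_const_of_iteratedDeriv_eq_const {f : ℝ → ℝ} (hfp : Function.Periodic f 1) {c : ℝ} :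
    ∀ {m : ℕ}, 1 ≤ m → ContDiff ℝ m f → (∀ x, iteratedDeriv m f x = c) →
      c = 0 ∧ ∀ x, f x = f 0 := by
  intro m
  induction m generalizing c with
  | zero => intro h; omega
  | succ m ih =>
    intro _ hf hc
    have hd : Differentiable ℝ (iteratedDeriv m f) :=
      hf.differentiable_iteratedDeriv m (by exact_mod_cast Nat.lt_succ_self m)
    have hlin : ∀ x, iteratedDeriv m f x = iteratedDeriv m f 0 + c * x := by
      have h0 : ∀ x, HasDerivAt (fun y => iteratedDeriv m f y - c * y) 0 x := by
        intro x
        have h1 := (hd x).hasDerivAt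
        rw [← iteratedDeriv_succ, hc] at h1
        exact (h1.fun_sub ((hasDerivAt_id x).const_mul c)).congr_deriv (by simp)
      intro x
      have := is_const_of_deriv_eq_zero (fun x => (h0 x).differentiableAt)
        (fun x => (h0 x).deriv) x 0
      simp only [mul_zero, sub_zero] at this
      linarith
    have hp : iteratedDeriv m f 1 = iteratedDeriv m f 0 := by
      simpa using periodic_iteratedDeriv hfp m 0
    have hc0 : c = 0 := by
      have := hlin 1
      linarith
    refine ⟨hc0, ?_⟩
    subst hc0
    rcases Nat.eq_zero_or_pos m with rfl | hm
    · intro x; simpa using hlin x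
    · exact (ih hm (hf.of_le (by exact_mod_cast Nat.le_succ m))
        (fun x => by rw [hlin x, zero_mul, add_zero])).2

theorem eval_eq_of_natDegree_le_one {q : Polynomial ℝ} (hq : q.natDegree ≤ 1) {a b c : ℝ}
    (hab : a ≠ b) (ha : q.eval a = c) (hb : q.eval b = c) (x : ℝ) : q.eval x = c := by
  obtain ⟨u, v, rfl⟩ := Polynomial.exists_eq_X_add_C_of_natDegree_le_one hq
  simp only [Polynomial.eval_add, Polynomial.eval_mul, Polynomial.eval_C,
    Polynomial.eval_X] at ha hb ⊢
  have : u * (a - b) = 0 := by linarith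
  rcases mul_eq_zero.1 this with h | h
  · simp [h] at ha ⊢; exact ha
  · exact absurd (sub_eq_zero.1 h) hab

/-- A linear map on splines which is injective, so that the dimension is at most `N`. -/
noncomputable def splineNodal (r N : ℕ) : splineSpace r N →ₗ[ℝ] (Fin N → ℝ) where
  toFun s i := iteratedDeriv (r - 2) (s : ℝ → ℝ) ((i : ℝ) / N) + (s : ℝ → ℝ) 0
  map_add' s t := by
    funext i
    simp only [Submodule.coe_add, Pi.add_apply]
    rw [iteratedDeriv_add s.2.2.1.contDiffAt t.2.2.1.contDiffAt]
    ring
  map_smul' c s := by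
    funext i
    simp only [Submodule.coe_smul, Pi.smul_apply, smul_eq_mul, RingHom.id_apply]
    rw [iteratedDeriv_const_smul_field]
    simp; ring

/-- The derivative of order `r - 2` is continuous and piecewise affine, so it is determined by its
nodal values; on the kernel these all equal `-s(0)`. It is therefore constant, and by periodicity it
is zero and `s` is constant. The summand `s(0)` in the map then forces this constant to vanish. -/
theorem splineNodal_injective (hr : 3 ≤ r) (hN : 1 ≤ N) :
    Function.Injective (splineNodal r N) := by
  rw [injective_iff_map_eq_zero]
  rintro ⟨s, hs⟩ h0
  have hN0 : (N : ℝ) ≠ 0 := by positivity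
  have hnode : ∀ i < N, iteratedDeriv (r - 2) s ((i : ℝ) / N) = - s 0 := by
    intro i hi
    have := congrFun h0 ⟨i, hi⟩
    simp only [splineNodal, LinearMap.coe_mk, AddHom.coe_mk, Pi.zero_apply] at this
    linarith
  have hper := periodic_iteratedDeriv hs.1 (r - 2)
  have hnode' : ∀ i ≤ N, iteratedDeriv (r - 2) s ((i : ℝ) / N) = - s 0 := by
    intro i hi
    rcases hi.lt_or_eq with h | rfl
    · exact hnode i h
    · rw [div_self hN0, ← zero_add (1 : ℝ), hper 0]
      simpa using hnode 0 hN
  have hcell : ∀ x ∈ Set.Ico (0 : ℝ) 1, iteratedDeriv (r - 2) s x = - s 0 := by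
    intro x hx
    have hNp : (0 : ℝ) < N := by exact_mod_cast hN
    have hx0 : 0 ≤ x * N := mul_nonneg hx.1 hNp.le
    have hiN : ⌊x * N⌋₊ < N := by
      rw [Nat.floor_lt hx0]; nlinarith [hx.2]
    set i := ⌊x * N⌋₊ with hi
    have hxi : x ∈ Set.Icc ((i : ℝ) / N) (((i : ℝ) + 1) / N) := by
      constructor
      · rw [div_le_iff₀ hNp]; exact Nat.floor_le hx0
      · rw [le_div_iff₀ hNp]; exact (Nat.lt_floor_add_one _).le
    obtain ⟨p, hpd, hp⟩ := hs.2.2 i hiN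
    rw [spline_iteratedDeriv_eq_closed hN hs le_rfl hp hxi]
    have hlt := cell_lt hN i
    refine eval_eq_of_natDegree_le_one ?_ hlt.ne ?_ ?_ x
    · by_cases hp0 : p = 0
      · rw [hp0, Polynomial.iterate_derivative_zero]; simp
      rw [Polynomial.mem_degreeLT, Polynomial.degree_eq_natDegree hp0] at hpd
      have hpd' : p.natDegree < r := by exact_mod_cast hpd
      have := Polynomial.natDegree_iterate_derivative p (r - 2)
      omega
    · rw [← spline_iteratedDeriv_eq_closed hN hs le_rfl hp (Set.left_mem_Icc.2 hlt.le)]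
      exact hnode' i hiN.le
    · rw [← spline_iteratedDeriv_eq_closed hN hs le_rfl hp (Set.right_mem_Icc.2 hlt.le)]
      exact_mod_cast hnode' (i + 1) hiN
  have hall : ∀ x, iteratedDeriv (r - 2) s x = - s 0 := by
    intro x
    obtain ⟨y, hy, hxy⟩ := hper.exists_mem_Ico₀ zero_lt_one x
    rw [hxy]
    exact hcell y hy
  obtain ⟨h1, h2⟩ := eq_const_of_iteratedDeriv_eq_const hs.1 (by omega) hs.2.1 hall
  refine Subtype.ext (funext fun x => ?_)
  have h3 := h2 x
  simp only [ZeroMemClass.coe_zero, Pi.zero_apply]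
  linarith

theorem finite_splineSpace (hr : 3 ≤ r) (hN : 1 ≤ N) : Module.Finite ℝ (splineSpace r N) :=
  Module.Finite.of_injective _ (splineNodal_injective hr hN)

theorem finrank_splineSpace_le (hr : 3 ≤ r) (hN : 1 ≤ N) :
    Module.finrank ℝ (splineSpace r N) ≤ N := by
  simpa using LinearMap.finrank_le_finrank_of_injective (splineNodal_injective hr hN)

end Spline

/-! ### Fourier partial sums as smooth approximations -/

/-- The frequency `2πin`. -/
noncomputable def freq (n : ℤ) : ℂ := 2 * Real.pi * Complex.I * n

/-- Fourier coefficients of a real function on `(0, 1]`. -/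
noncomputable def perFourier (f : ℝ → ℝ) (n : ℤ) : ℂ :=
  fourierCoeff (AddCircle.liftIoc (1 : ℝ) 0 fun x => (f x : ℂ)) n

theorem fourier_coe_eq_exp (n : ℤ) (x : ℝ) :
    fourier n (x : AddCircle (1 : ℝ)) = Complex.exp (freq n * x) := by
  rw [fourier_coe_apply, freq]
  simp

theorem perFourier_eq_integral (f : ℝ → ℝ) (n : ℤ) :
    perFourier f n = ∫ x, (f x : ℂ) * Complex.exp (freq (-n) * x) ∂perMeasure := by
  rw [perFourier, fourierCoeff_eq_intervalIntegral _ _ 0, zero_add,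
    intervalIntegral.integral_of_le zero_le_one, perMeasure]
  simp only [div_one, one_smul]
  refine setIntegral_congr_fun measurableSet_Ioc fun x hx => ?_
  rw [AddCircle.liftIoc_coe_apply (by simpa using hx), fourier_coe_eq_exp, smul_eq_mul, mul_comm]

theorem hasDerivAt_clm_exp (L : ℂ →L[ℝ] ℝ) (A c : ℂ) (x : ℝ) :
    HasDerivAt (fun y : ℝ => L (A * Complex.exp (c * y))) (L (A * c * Complex.exp (c * x))) x := by
  have h1 : HasDerivAt (fun y : ℝ => c * (y : ℂ)) c x := by
    simpa using (Complex.ofRealCLM.hasDerivAt (x := x)).const_mul c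
  have h2 := L.hasFDerivAt.comp_hasDerivAt x (h1.cexp.const_mul A)
  refine h2.congr_deriv ?_
  congr 1
  ring

theorem iteratedDeriv_clm_exp (L : ℂ →L[ℝ] ℝ) (A c : ℂ) (k : ℕ) :
    iteratedDeriv k (fun y : ℝ => L (A * Complex.exp (c * y)))
      = fun y : ℝ => L (A * c ^ k * Complex.exp (c * y)) := by
  induction k with
  | zero => simp
  | succ k ih =>
    rw [iteratedDeriv_succ, ih]
    funext x
    rw [(hasDerivAt_clm_exp L (A * c ^ k) c x).deriv]
    ring_nf

theorem contDiff_clm_exp (L : ℂ →L[ℝ] ℝ) (A c : ℂ) :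
    ContDiff ℝ ∞ (fun y : ℝ => L (A * Complex.exp (c * y))) := by
  refine L.contDiff.comp (contDiff_const.mul ?_)
  exact Complex.contDiff_exp.comp (contDiff_const.mul Complex.ofRealCLM.contDiff)

theorem exp_freq_periodic (n : ℤ) (x : ℝ) :
    Complex.exp (freq n * ((x + 1 : ℝ) : ℂ)) = Complex.exp (freq n * x) := by
  have h : freq n * ((x + 1 : ℝ) : ℂ) = freq n * x + n * (2 * Real.pi * Complex.I) := by
    rw [freq]; push_cast; ring
  rw [h, Complex.exp_periodic.int_mul n]

theorem periodic_clm_exp (L : ℂ →L[ℝ] ℝ) (A : ℂ) (n : ℤ) :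
    Function.Periodic (fun y : ℝ => L (A * Complex.exp (freq n * y))) 1 := by
  intro x
  dsimp only
  rw [exp_freq_periodic]

theorem freq_neg (n : ℤ) : freq (-n) = -freq n := by
  simp [freq]

theorem integrable_mul_exp {f : ℝ → ℝ} (hf : Integrable f perMeasure) (A c : ℂ) :
    Integrable (fun x : ℝ => (f x : ℂ) * (A * Complex.exp (c * x))) perMeasure := by
  have hc : Continuous fun x : ℝ => A * Complex.exp (c * x) := by fun_prop
  obtain ⟨B, hB⟩ := (isCompact_Icc (a := (0 : ℝ)) (b := 1)).exists_bound_of_continuousOn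
    hc.continuousOn
  refine hf.ofReal.mul_bdd (c := B) hc.aestronglyMeasurable ?_
  filter_upwards [ae_restrict_mem measurableSet_Ioc] with x hx
  exact hB x (Set.Ioc_subset_Icc_self hx)

/-- Test functions are real, so the exponential is tested through a real-linear functional; the real
and imaginary parts are the cases needed. -/
theorem HasPerWeakDeriv.clm_exp {k : ℕ} {f g : ℝ → ℝ} (h : HasPerWeakDeriv k f g)
    (L : ℂ →L[ℝ] ℝ) (n : ℤ) :
    L (∫ x, (f x : ℂ) * (freq n ^ k * Complex.exp (freq n * x)) ∂perMeasure)
      = L ((-1) ^ k * ∫ x, (g x : ℂ) * Complex.exp (freq n * x) ∂perMeasure) := by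
  have h1 := h.integral_eq _ (contDiff_clm_exp L 1 (freq n)) (periodic_clm_exp L 1 n)
  rw [iteratedDeriv_clm_exp] at h1
  have hre : ∀ (f : ℝ → ℝ), Integrable f perMeasure → ∀ A : ℂ,
      L (∫ x, (f x : ℂ) * (A * Complex.exp (freq n * x)) ∂perMeasure)
        = ∫ x, f x * L (A * Complex.exp (freq n * x)) ∂perMeasure := by
    intro f hf A
    rw [← L.integral_comp_comm (integrable_mul_exp hf A _)]
    refine integral_congr_ae (Filter.Eventually.of_forall fun x => ?_)
    dsimp only
    rw [← Complex.real_smul, L.map_smul, smul_eq_mul]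
  have h2 := hre g h.integrable_right 1
  simp only [one_mul] at h1 h2
  rw [hre f h.integrable_left, h1, ← h2]
  have : ((-1 : ℂ) ^ k) = (((-1 : ℝ) ^ k : ℝ) : ℂ) := by push_cast; ring
  rw [this, ← Complex.real_smul, L.map_smul, smul_eq_mul]

theorem HasPerWeakDeriv.perFourier_eq {k : ℕ} {f g : ℝ → ℝ} (h : HasPerWeakDeriv k f g)
    (n : ℤ) : perFourier g n = freq n ^ k * perFourier f n := by
  have h1 : ∫ x, (f x : ℂ) * (freq (-n) ^ k * Complex.exp (freq (-n) * x)) ∂perMeasure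
      = (-1) ^ k * ∫ x, (g x : ℂ) * Complex.exp (freq (-n) * x) ∂perMeasure :=
    Complex.ext (h.clm_exp Complex.reCLM (-n)) (h.clm_exp Complex.imCLM (-n))
  have h2 : ∫ x, (f x : ℂ) * (freq (-n) ^ k * Complex.exp (freq (-n) * x)) ∂perMeasure
      = freq (-n) ^ k * perFourier f n := by
    rw [perFourier_eq_integral, ← integral_const_mul]
    congr 1; funext x; ring
  rw [h2, ← perFourier_eq_integral, freq_neg, neg_pow, mul_assoc] at h1
  exact (mul_left_cancel₀ (pow_ne_zero k (by norm_num)) h1).symm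

/-- Partial sums of the Fourier series. -/
noncomputable def fourierPartial (f : ℝ → ℝ) (M : ℕ) (x : ℝ) : ℝ :=
  ∑ n ∈ Finset.Icc (-M : ℤ) M, (perFourier f n * Complex.exp (freq n * x)).re

theorem fourierPartial_periodic (f : ℝ → ℝ) (M : ℕ) :
    Function.Periodic (fourierPartial f M) 1 := by
  intro x
  simp only [fourierPartial, exp_freq_periodic]

theorem fourierPartial_contDiff (f : ℝ → ℝ) (M : ℕ) : ContDiff ℝ ∞ (fourierPartial f M) :=
  ContDiff.sum fun n _ => contDiff_clm_exp Complex.reCLM (perFourier f n) (freq n)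

/-- One smooth sequence thus approximates `f` together with all its weak derivatives. -/
theorem HasPerWeakDeriv.iteratedDeriv_fourierPartial {k : ℕ} {f g : ℝ → ℝ}
    (h : HasPerWeakDeriv k f g) (M : ℕ) :
    iteratedDeriv k (fourierPartial f M) = fourierPartial g M := by
  funext x
  have h1 : fourierPartial f M = fun x : ℝ => ∑ n ∈ Finset.Icc (-M : ℤ) M,
      Complex.reCLM (perFourier f n * Complex.exp (freq n * x)) := rfl
  rw [h1, iteratedDeriv_fun_sum]
  · refine Finset.sum_congr rfl fun n _ => ?_
    rw [iteratedDeriv_clm_exp, h.perFourier_eq, mul_comm (freq n ^ k)]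
    rfl
  · intro n _
    exact (contDiff_clm_exp Complex.reCLM _ _).contDiffAt.of_le (by exact_mod_cast le_top)

theorem haarAddCircle_one : (AddCircle.haarAddCircle : Measure (AddCircle (1 : ℝ))) = volume := by
  rw [AddCircle.volume_eq_smul_haarAddCircle]
  simp

theorem memLp_liftIoc_perMeasure {f : ℝ → ℝ} (hf : MemLp f 2 perMeasure) :
    MemLp (AddCircle.liftIoc (1 : ℝ) 0 fun x => (f x : ℂ)) 2
      (AddCircle.haarAddCircle : Measure (AddCircle (1 : ℝ))) := by
  have h1 : MemLp (fun x => (f x : ℂ)) 2 (volume.restrict (Set.Ioc (0 : ℝ) (0 + 1))) := by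
    simpa [perMeasure] using hf.ofReal (K := ℂ)
  exact h1.memLp_liftIoc.haarAddCircle

/-- The `L²` convergence on the circle is pulled back along the measure-preserving quotient map.
Since `f` is real, taking real parts does not increase the error. -/
theorem tendsto_fourierPartial {f : ℝ → ℝ} (hf : MemLp f 2 perMeasure) :
    Filter.Tendsto (fun M => eLpNorm (fourierPartial f M - f) 2 perMeasure) Filter.atTop
      (nhds 0) := by
  have hF := memLp_liftIoc_perMeasure hf
  set F := AddCircle.liftIoc (1 : ℝ) 0 fun x => (f x : ℂ) with hFdef
  have hsum := (hasSum_fourier_series_L2 hF.toLp).comp Finset.tendsto_Icc_neg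
  rw [Lp.tendsto_Lp_iff_tendsto_eLpNorm] at hsum
  refine tendsto_of_tendsto_of_tendsto_of_le_of_le tendsto_const_nhds hsum
    (fun _ => zero_le) fun M => ?_
  have hmp : MeasurePreserving ((↑) : ℝ → AddCircle (1 : ℝ)) perMeasure
      AddCircle.haarAddCircle := by
    have := AddCircle.measurePreserving_mk (1 : ℝ) 0
    rw [haarAddCircle_one, perMeasure]
    simpa using this
  set P : C(AddCircle (1 : ℝ), ℂ) :=
    ∑ n ∈ Finset.Icc (-M : ℤ) M, perFourier f n • fourier n with hP
  have hcoef : ∀ n, fourierCoeff (hF.toLp F) n = perFourier f n := fun n =>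
    congrFun (fourierCoeff_congr_ae hF.coeFn_toLp) n
  have hPL : ((fun s : Finset ℤ => ∑ b ∈ s, fourierCoeff (hF.toLp F) b • fourierLp 2 b) ∘
      fun n : ℕ => Finset.Icc (-n : ℤ) n) M
      = ContinuousMap.toLp (E := ℂ) 2 AddCircle.haarAddCircle ℂ P := by
    simp only [Function.comp, hP, map_sum, map_smul, hcoef]
  rw [hPL]
  have h3 : eLpNorm (⇑(ContinuousMap.toLp (E := ℂ) 2 AddCircle.haarAddCircle ℂ P) - F) 2
      AddCircle.haarAddCircle = eLpNorm (⇑P - F) 2 AddCircle.haarAddCircle :=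
    eLpNorm_congr_ae ((ContinuousMap.coeFn_toLp (𝕜 := ℂ) _ P).sub (Filter.EventuallyEq.refl _ _))
  have hmeas : AEStronglyMeasurable (⇑P - F)
      (AddCircle.haarAddCircle : Measure (AddCircle (1 : ℝ))) :=
    P.continuous.aestronglyMeasurable.sub hF.aestronglyMeasurable
  rw [h3, ← eLpNorm_comp_measurePreserving hmeas hmp]
  refine eLpNorm_mono_ae ?_
  filter_upwards [ae_restrict_mem measurableSet_Ioc] with x hx
  have hFx : F (x : AddCircle (1 : ℝ)) = f x :=
    AddCircle.liftIoc_coe_apply (by simpa using hx)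
  have hPx : (fourierPartial f M x) = (P (x : AddCircle (1 : ℝ))).re := by
    simp only [fourierPartial, hP, ContinuousMap.coe_sum, ContinuousMap.coe_smul,
      Finset.sum_apply, Pi.smul_apply, smul_eq_mul, fourier_coe_eq_exp, Complex.re_sum]
  simp only [Pi.sub_apply, Function.comp, hFx, hPx]
  rw [← Complex.ofReal_re (f x), ← Complex.sub_re]
  exact Complex.abs_re_le_norm _

theorem summable_perFourier {f g : ℝ → ℝ} (h : HasPerWeakDeriv 1 f g)
    (hg : MemLp g 2 perMeasure) : Summable (perFourier f) := by
  have hG := memLp_liftIoc_perMeasure hg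
  have h1 := (hasSum_sq_fourierCoeff hG.toLp).summable
  have hcoef : ∀ n, fourierCoeff (hG.toLp _) n = perFourier g n := fun n =>
    congrFun (fourierCoeff_congr_ae hG.coeFn_toLp) n
  simp only [hcoef] at h1
  have h2 : Summable fun n : ℤ => 1 / (n : ℝ) ^ 2 := Real.summable_one_div_int_pow.2 one_lt_two
  -- The term `n = 0` needs its own majorant; the others obey `2|f̂(n)| ≤ |n f̂(n)|² + 1/n²`, and
  -- `|n f̂(n)| ≤ |ĝ(n)|`.
  have h3 : Summable fun n : ℤ => if n = 0 then ‖perFourier f 0‖ else 0 :=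
    (hasSum_ite_eq (0 : ℤ) ‖perFourier f 0‖).summable
  refine Summable.of_norm_bounded ((h1.add h2).add h3) fun n => ?_
  rcases eq_or_ne n 0 with rfl | hn
  · simp only [if_true]
    have : 0 ≤ ‖perFourier g 0‖ ^ 2 + 1 / ((0 : ℤ) : ℝ) ^ 2 := by positivity
    linarith
  · rw [if_neg hn, add_zero, h.perFourier_eq, pow_one, norm_mul]
    have hn' : (0 : ℝ) < |(n : ℝ)| := abs_pos.2 (by exact_mod_cast hn)
    have hfr : |(n : ℝ)| ≤ ‖freq n‖ := by
      have : ‖freq n‖ = 2 * Real.pi * |(n : ℝ)| := by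
        simp [freq, Real.pi_pos.le]
      rw [this]
      nlinarith [Real.pi_gt_three]
    set a := ‖perFourier f n‖
    have ha : 0 ≤ a := norm_nonneg _
    rw [← sq_abs (n : ℝ)]
    set m := |(n : ℝ)|
    have h5 : (m * a) ^ 2 ≤ (‖freq n‖ * a) ^ 2 := by gcongr
    have h6 : 2 * a ≤ (m * a) ^ 2 + 1 / m ^ 2 := by
      have h7 := sq_nonneg (m * a - 1 / m)
      have h8 : (m * a - 1 / m) ^ 2 = (m * a) ^ 2 + 1 / m ^ 2 - 2 * a := by
        field_simp; ring
      linarith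
    linarith

/-- Quasiinterpolants sample point values, so `L²` convergence alone would not suffice. -/
theorem tendsto_fourierPartial_apply {f g : ℝ → ℝ} (hfp : Function.Periodic f 1)
    (hfc : Continuous f) (h : HasPerWeakDeriv 1 f g) (hg : MemLp g 2 perMeasure) (x : ℝ) :
    Filter.Tendsto (fun M => fourierPartial f M x) Filter.atTop (nhds (f x)) := by
  have hs := summable_perFourier h hg
  set F : C(AddCircle (1 : ℝ), ℂ) := ⟨AddCircle.liftIoc (1 : ℝ) 0 fun x => (f x : ℂ),
    AddCircle.liftIoc_zero_continuous (by simpa using (hfp 0).symm)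
      (Continuous.continuousOn (by fun_prop))⟩ with hF
  have h1 := (has_pointwise_sum_fourier_series_of_summable (f := F) hs (x : AddCircle (1 : ℝ)))
  have hFx : F (x : AddCircle (1 : ℝ)) = f x := by
    obtain ⟨n, hn, -⟩ := existsUnique_sub_zsmul_mem_Ioc zero_lt_one x (0 : ℝ)
    have hxy : (x : AddCircle (1 : ℝ)) = ((x - n • (1 : ℝ) : ℝ) : AddCircle (1 : ℝ)) := by
      rw [AddCircle.coe_sub, AddCircle.coe_zsmul, AddCircle.coe_period, smul_zero, sub_zero]
    rw [hxy, ← hfp.sub_zsmul_eq n]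
    exact AddCircle.liftIoc_coe_apply (f := fun x => (f x : ℂ)) hn
  rw [hFx] at h1
  have h2 := (Complex.continuous_re.tendsto _).comp (h1.comp Finset.tendsto_Icc_neg)
  refine h2.congr fun M => ?_
  simp only [Function.comp, fourierPartial, Complex.re_sum, smul_eq_mul, fourier_coe_eq_exp]
  rfl

theorem eLpNorm_two_sq (f : ℝ → ℝ) (μ : Measure ℝ) :
    eLpNorm f 2 μ ^ 2 = ∫⁻ x, ENNReal.ofReal (f x ^ 2) ∂μ := by
  have h := eLpNorm_nnreal_pow_eq_lintegral (f := f) (μ := μ) (p := 2) two_ne_zero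
  simp only [NNReal.coe_ofNat, ENNReal.coe_ofNat, ENNReal.rpow_ofNat] at h
  rw [h]
  refine lintegral_congr fun x => ?_
  rw [Real.enorm_eq_ofReal_abs, ← ENNReal.ofReal_pow (abs_nonneg _), sq_abs]

theorem eLpNorm_two_sq_perMeasure {f : ℝ → ℝ} (hf : Continuous f) :
    eLpNorm f 2 perMeasure ^ 2 = ENNReal.ofReal (∫ x in (0 : ℝ)..1, f x ^ 2) := by
  rw [eLpNorm_two_sq, ← integral_perMeasure, ofReal_integral_eq_lintegral_ofReal]
  · exact ((hf.pow 2).integrableOn_Icc).mono_set Set.Ioc_subset_Icc_self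
  · exact Filter.Eventually.of_forall fun x => sq_nonneg _

theorem eLpNorm_two_perMeasure {f : ℝ → ℝ} (hf : Continuous f) :
    eLpNorm f 2 perMeasure = ENNReal.ofReal (√(∫ x in (0 : ℝ)..1, f x ^ 2)) := by
  have h0 : 0 ≤ ∫ x in (0 : ℝ)..1, f x ^ 2 :=
    intervalIntegral.integral_nonneg zero_le_one fun _ _ => sq_nonneg _
  refine (ENNReal.pow_right_strictMono two_ne_zero).injective ?_
  rw [eLpNorm_two_sq_perMeasure hf, ← ENNReal.ofReal_pow (Real.sqrt_nonneg _), Real.sq_sqrt h0]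

/-! ### From the `L²` order to derivatives and the sup norm, for smooth functions -/

section Smooth

/-- On every cell the `k`-th derivative of the error of a spline is controlled pointwise by the
error in `L²` and by the `r`-th derivative. -/
theorem exists_cell_error_bound (r k : ℕ) (hk : k < r) : ∃ C : ℝ, 0 ≤ C ∧
    ∀ N, 1 ≤ N → ∀ s ∈ splineSpace r N, ∀ v : ℝ → ℝ, ContDiff ℝ ∞ v → ∀ i < N,
      ∀ x ∈ Set.Ioo ((i : ℝ) / N) (((i : ℝ) + 1) / N),
        (1 / (N : ℝ)) ^ (2 * k + 1) * (iteratedDeriv k s x - iteratedDeriv k v x) ^ 2 ≤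
          C * ((∫ t in ((i : ℝ) / N)..(((i : ℝ) + 1) / N), (s t - v t) ^ 2) +
            (1 / (N : ℝ)) ^ (2 * r) *
              ∫ t in ((i : ℝ) / N)..(((i : ℝ) + 1) / N), iteratedDeriv r v t ^ 2) := by
  obtain ⟨C, hC0, hC⟩ := sq_iteratedDeriv_le_interval r k hk
  refine ⟨C, hC0, fun N hN s hs v hv i hi x hx => ?_⟩
  have hN0 : (0 : ℝ) < N := by exact_mod_cast hN
  obtain ⟨p, hpd, hp⟩ := hs.2.2 i hi
  have hps : ContDiff ℝ ∞ fun x => p.eval x := contDiff_polynomial_eval p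
  have e : (i : ℝ) / N + 1 / N = ((i : ℝ) + 1) / N := by rw [add_div]
  have h := hC (fun y => p.eval y - v y) (hps.sub hv) ((i : ℝ) / N) (1 / N) (by positivity) x
    (by rw [e]; exact Set.Ioo_subset_Icc_self hx)
  rw [e] at h
  simp only [iteratedDeriv_sub_of_smooth hps hv, iteratedDeriv_polynomial_eval,
    iterate_derivative_eq_zero_of_mem_degreeLT hpd le_rfl, Polynomial.eval_zero, zero_sub,
    neg_sq] at h
  have hI : ∫ t in ((i : ℝ) / N)..(((i : ℝ) + 1) / N), (s t - v t) ^ 2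
      = ∫ t in ((i : ℝ) / N)..(((i : ℝ) + 1) / N), (p.eval t - v t) ^ 2 := by
    refine intervalIntegral.integral_congr fun t ht => ?_
    rw [Set.uIcc_of_le (cell_lt hN i).le] at ht
    simp only [hp t ht]
  rw [spline_iteratedDeriv_eq hp hx, hI]
  exact h

/-- The cell bound has the form `C B_i / h^(2k+1)` with `∑ B_i` of order `h^(2r)`. In `L²`,
integrating over a cell regains one factor `h` before summing. In the sup norm, `B_i` is merely
estimated by the whole sum, and half a power of `h` is lost. -/
theorem exists_smooth_error_bound (r k : ℕ) (hk : k < r) (A : ℝ) : ∃ K : ℝ, 0 < K ∧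
    ∀ N, 1 ≤ N → ∀ s ∈ splineSpace r N, ∀ v : ℝ → ℝ, ContDiff ℝ ∞ v →
      eLpNorm (s - v) 2 perMeasure ≤
        ENNReal.ofReal (A * (1 / (N : ℝ)) ^ r) * eLpNorm (iteratedDeriv r v) 2 perMeasure →
      eLpNorm (iteratedDeriv k s - iteratedDeriv k v) 2 perMeasure ≤
        ENNReal.ofReal (K * (1 / (N : ℝ)) ^ (r - k)) * eLpNorm (iteratedDeriv r v) 2 perMeasure ∧
      eLpNorm (iteratedDeriv k s - iteratedDeriv k v) ⊤ perMeasure ≤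
        ENNReal.ofReal (K * (1 / (N : ℝ)) ^ ((r : ℝ) - (k : ℝ) - 1 / 2)) *
          eLpNorm (iteratedDeriv r v) 2 perMeasure := by
  obtain ⟨C, hC0, hC⟩ := exists_cell_error_bound r k hk
  set D : ℝ := (C + 1) * (A ^ 2 + 1) with hD
  have hDpos : 0 < D := by positivity
  refine ⟨√D, Real.sqrt_pos.2 hDpos, fun N hN s hs v hv hA => ?_⟩
  have hN0 : (0 : ℝ) < N := by exact_mod_cast hN
  set h : ℝ := 1 / N with hh
  have hpos : 0 < h := by positivity
  have hsc := continuous_spline hs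
  have hrc := continuous_iteratedDeriv_of_smooth hv r
  have hec : Continuous fun t => s t - v t := hsc.sub hv.continuous
  set J := ∫ t in (0 : ℝ)..1, iteratedDeriv r v t ^ 2 with hJ
  have hJ0 : 0 ≤ J := intervalIntegral.integral_nonneg zero_le_one fun _ _ => sq_nonneg _
  -- the hypothesis as an inequality of real integrals
  have hE : ∫ t in (0 : ℝ)..1, (s t - v t) ^ 2 ≤ A ^ 2 * h ^ (2 * r) * J := by
    have h1 : eLpNorm (fun t => s t - v t) 2 perMeasure ≤
        ENNReal.ofReal (A * h ^ r) * eLpNorm (iteratedDeriv r v) 2 perMeasure := hA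
    have h2 : ENNReal.ofReal (A * h ^ r) ≤ ENNReal.ofReal (|A| * h ^ r) :=
      ENNReal.ofReal_le_ofReal (by gcongr; exact le_abs_self A)
    have h3 := h1.trans (mul_le_mul_left h2 _)
    rw [eLpNorm_two_perMeasure hec, eLpNorm_two_perMeasure hrc,
      ← ENNReal.ofReal_mul (by positivity), ENNReal.ofReal_le_ofReal_iff (by positivity),
      Real.sqrt_le_left (by positivity)] at h3
    rw [mul_pow, mul_pow, sq_abs, Real.sq_sqrt hJ0] at h3
    rwa [mul_comm 2 r, pow_mul]
  set B : ℕ → ℝ := fun i => (∫ t in ((i : ℝ) / N)..(((i : ℝ) + 1) / N), (s t - v t) ^ 2) +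
    h ^ (2 * r) * ∫ t in ((i : ℝ) / N)..(((i : ℝ) + 1) / N), iteratedDeriv r v t ^ 2 with hB
  have hB0 : ∀ i, 0 ≤ B i := fun i => by
    refine add_nonneg ?_ (mul_nonneg (by positivity) ?_) <;>
      exact intervalIntegral.integral_nonneg (cell_lt hN i).le fun _ _ => sq_nonneg _
  have hBsum : ∑ i ∈ Finset.range N, B i ≤ (A ^ 2 + 1) * h ^ (2 * r) * J := by
    have h1 := sum_integral_cells hN (f := fun t => (s t - v t) ^ 2) (hec.pow 2)
    have h2 := sum_integral_cells hN (f := fun t => iteratedDeriv r v t ^ 2) (hrc.pow 2)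
    rw [hB, Finset.sum_add_distrib, ← Finset.mul_sum, h1, h2]
    linarith
  -- the pointwise bound on a cell
  have hpt : ∀ i < N, ∀ x ∈ Set.Ioo ((i : ℝ) / N) (((i : ℝ) + 1) / N),
      (iteratedDeriv k s x - iteratedDeriv k v x) ^ 2 ≤ C * B i / h ^ (2 * k + 1) := by
    intro i hi x hx
    rw [le_div_iff₀ (by positivity), mul_comm]
    exact hC N hN s hs v hv i hi x hx
  have hCB : C * ∑ i ∈ Finset.range N, B i ≤ D * h ^ (2 * r) * J := by
    calc C * ∑ i ∈ Finset.range N, B i ≤ (C + 1) * ((A ^ 2 + 1) * h ^ (2 * r) * J) := by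
          refine mul_le_mul (by linarith) hBsum (Finset.sum_nonneg fun i _ => hB0 i) (by linarith)
      _ = _ := by rw [hD]; ring
  rw [eLpNorm_two_perMeasure hrc, ← hJ, ← ENNReal.ofReal_mul (by positivity),
    ← ENNReal.ofReal_mul (by positivity)]
  constructor
  · refine (ENNReal.pow_right_strictMono two_ne_zero).le_iff_le.1 ?_
    rw [eLpNorm_two_sq, lintegral_perMeasure_eq_sum hN]
    have hcell : ∀ i ∈ Finset.range N,
        ∫⁻ x in Set.Ioc ((i : ℝ) / N) (((i : ℝ) + 1) / N),
          ENNReal.ofReal ((iteratedDeriv k s - iteratedDeriv k v) x ^ 2)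
        ≤ ENNReal.ofReal (C * B i / h ^ (2 * k)) := by
      intro i hi
      rw [← restrict_Ioo_eq_restrict_Ioc]
      calc _ ≤ ∫⁻ _ in Set.Ioo ((i : ℝ) / N) (((i : ℝ) + 1) / N),
            ENNReal.ofReal (C * B i / h ^ (2 * k + 1)) :=
          setLIntegral_mono' measurableSet_Ioo fun x hx =>
            ENNReal.ofReal_le_ofReal (hpt i (Finset.mem_range.1 hi) x hx)
        _ = _ := by
          rw [lintegral_const, Measure.restrict_apply_univ, Real.volume_Ioo,
            ← ENNReal.ofReal_mul (div_nonneg (mul_nonneg hC0 (hB0 i)) (by positivity))]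
          congr 1
          have : ((i : ℝ) + 1) / N - i / N = h := by rw [hh]; ring
          rw [this]
          field_simp
          ring
    refine (Finset.sum_le_sum hcell).trans ?_
    rw [← ENNReal.ofReal_sum_of_nonneg fun i _ =>
      div_nonneg (mul_nonneg hC0 (hB0 i)) (by positivity), ← ENNReal.ofReal_pow (by positivity),
      ← Finset.sum_div, ← Finset.mul_sum]
    refine ENNReal.ofReal_le_ofReal ?_
    rw [div_le_iff₀ (by positivity)]
    refine hCB.trans (le_of_eq ?_)
    have h3 : (h ^ (r - k)) ^ 2 * h ^ (2 * k) = h ^ (2 * r) := by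
      rw [← pow_mul, ← pow_add]
      congr 1
      omega
    rw [mul_pow, mul_pow, Real.sq_sqrt hDpos.le, Real.sq_sqrt hJ0, ← h3]
    ring
  · rw [eLpNorm_exponent_top]
    refine eLpNormEssSup_le_of_ae_bound ?_
    filter_upwards [ae_exists_cell hN] with x hx
    obtain ⟨i, hi, hx⟩ := hx
    have h1 := hpt i hi x hx
    have h2 : C * B i ≤ D * h ^ (2 * r) * J :=
      (mul_le_mul_of_nonneg_left (Finset.single_le_sum (fun j _ => hB0 j)
        (Finset.mem_range.2 hi)) hC0).trans hCB
    rw [Pi.sub_apply, Real.norm_eq_abs]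
    refine abs_le_of_sq_le_sq ?_ (by positivity)
    refine h1.trans ?_
    rw [div_le_iff₀ (by positivity)]
    refine h2.trans (le_of_eq ?_)
    have h3 : (h ^ ((r : ℝ) - (k : ℝ) - 1 / 2)) ^ 2 * h ^ (2 * k + 1) = h ^ (2 * r) := by
      rw [← Real.rpow_natCast, ← Real.rpow_natCast, ← Real.rpow_natCast, ← Real.rpow_mul hpos.le,
        ← Real.rpow_add hpos]
      congr 1
      push_cast
      ring
    rw [mul_pow, mul_pow, Real.sq_sqrt hDpos.le, Real.sq_sqrt hJ0, ← h3]
    ring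

end Smooth

/-! ### Extension to functions with weak derivatives -/

theorem quasiInterp_mem {r N : ℕ} {φ : Fin N → ℝ → ℝ} (hφ : ∀ j, φ j ∈ splineSpace r N)
    (v : ℝ → ℝ) : quasiInterp φ v ∈ splineSpace r N := by
  have h : quasiInterp φ v = ∑ j : Fin N, v (((j : ℝ) + 1) / N) • φ j := by
    funext x
    simp [quasiInterp, Finset.sum_apply]
  rw [h]
  exact Submodule.sum_mem _ fun j _ => Submodule.smul_mem _ _ (hφ j)

theorem IsQuasiInterpBasis.mem {r : ℕ} {φ : ∀ N : ℕ, Fin N → ℝ → ℝ}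
    (h : IsQuasiInterpBasis r φ) {N : ℕ} (hN : 1 ≤ N) (j : Fin N) : φ N j ∈ splineSpace r N := by
  rw [← h.span_eq N hN]
  exact Submodule.subset_span ⟨j, rfl⟩

theorem iteratedDeriv_quasiInterp {r N i : ℕ} {φ : Fin N → ℝ → ℝ}
    (hφ : ∀ j, φ j ∈ splineSpace r N) (hi : i < N) (v : ℝ → ℝ) (k : ℕ) {x : ℝ}
    (hx : x ∈ Set.Ioo ((i : ℝ) / N) (((i : ℝ) + 1) / N)) :
    iteratedDeriv k (quasiInterp φ v) x
      = ∑ j : Fin N, v (((j : ℝ) + 1) / N) * iteratedDeriv k (φ j) x := by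
  have hc : ∀ j, ContDiffAt ℝ k (φ j) x := fun j => by
    obtain ⟨p, -, hp⟩ := (hφ j).2.2 i hi
    exact (spline_contDiffAt hp hx).of_le (by exact_mod_cast le_top)
  have h : quasiInterp φ v = fun x => ∑ j : Fin N, v (((j : ℝ) + 1) / N) * φ j x := rfl
  rw [h, iteratedDeriv_fun_sum fun j _ => contDiffAt_const.mul (hc j)]
  simp only [iteratedDeriv_const_mul_field]

/-- An error estimate for smooth functions extends to functions with weak derivatives in `L²`. -/
theorem quasiInterp_error_of_smooth {r N k : ℕ} (hr : 1 ≤ r) (hN : 1 ≤ N) (hk : k ≤ r)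
    {φ : Fin N → ℝ → ℝ} (hφ : ∀ j, φ j ∈ splineSpace r N) {p c : ℝ≥0∞} (hc : c ≠ ⊤)
    (H : ∀ w : ℝ → ℝ, Function.Periodic w 1 → ContDiff ℝ ∞ w →
      eLpNorm (iteratedDeriv k (quasiInterp φ w) - iteratedDeriv k w) p perMeasure ≤
        c * eLpNorm (iteratedDeriv r w) 2 perMeasure)
    {v : ℝ → ℝ} (hvp : Function.Periodic v 1) (hvc : Continuous v) {G : ℕ → ℝ → ℝ}
    (hG : ∀ i ≤ r, HasPerWeakDeriv i v (G i)) (hL : ∀ i ≤ r, MemLp (G i) 2 perMeasure) :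
    eLpNorm (iteratedDeriv k (quasiInterp φ v) - G k) p perMeasure ≤
      c * eLpNorm (G r) 2 perMeasure := by
  set w := fourierPartial v with hw
  have hwk : ∀ M, iteratedDeriv k (w M) = fourierPartial (G k) M := fun M =>
    (hG k hk).iteratedDeriv_fourierPartial M
  have hwr : ∀ M, iteratedDeriv r (w M) = fourierPartial (G r) M := fun M =>
    (hG r le_rfl).iteratedDeriv_fourierPartial M
  have hmeas : ∀ f M, AEStronglyMeasurable (fourierPartial f M) perMeasure := fun f M =>
    (fourierPartial_contDiff f M).continuous.aestronglyMeasurable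
  -- Almost everywhere convergence along a subsequence is enough for the Fatou-type bound used
  -- below, which also covers `p = ∞`.
  obtain ⟨ns, hns, hae⟩ := (tendstoInMeasure_of_tendsto_eLpNorm two_ne_zero (hmeas (G k))
    (hL k hk).aestronglyMeasurable (tendsto_fourierPartial (hL k hk))).exists_seq_tendsto_ae
  set f : ℕ → ℝ → ℝ := fun n =>
    iteratedDeriv k (quasiInterp φ (w (ns n))) - iteratedDeriv k (w (ns n)) with hf
  have hfm : ∀ n, AEStronglyMeasurable (f n) perMeasure := fun n => by
    refine (memLp_iteratedDeriv_spline hN (quasiInterp_mem hφ _) k 2).aestronglyMeasurable.sub ?_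
    rw [hwk]
    exact hmeas _ _
  have hlim : ∀ᵐ x ∂perMeasure, Filter.Tendsto (fun n => f n x) Filter.atTop
      (nhds ((iteratedDeriv k (quasiInterp φ v) - G k) x)) := by
    filter_upwards [hae, ae_exists_cell hN] with x hx hcell
    obtain ⟨i, hi, hxi⟩ := hcell
    simp only [hf, Pi.sub_apply, hwk]
    refine Filter.Tendsto.sub ?_ hx
    simp only [iteratedDeriv_quasiInterp hφ hi _ k hxi]
    -- For fixed `N` the quasiinterpolant depends on finitely many nodal values, and these converge.
    refine tendsto_finsetSum _ fun j _ => Filter.Tendsto.mul_const _ ?_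
    exact (tendsto_fourierPartial_apply hvp hvc (hG 1 hr) (hL 1 hr) _).comp hns.tendsto_atTop
  refine (Lp.eLpNorm_lim_le_liminf_eLpNorm hfm _ hlim).trans ?_
  have hb : ∀ n, eLpNorm (f n) p perMeasure ≤
      c * (eLpNorm (fourierPartial (G r) (ns n) - G r) 2 perMeasure
        + eLpNorm (G r) 2 perMeasure) := by
    intro n
    refine (H _ (fourierPartial_periodic v _) (fourierPartial_contDiff v _)).trans ?_
    gcongr
    have h1 : iteratedDeriv r (fourierPartial v (ns n))
        = (fourierPartial (G r) (ns n) - G r) + G r := by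
      rw [sub_add_cancel]; exact hwr _
    rw [h1]
    exact eLpNorm_add_le ((hmeas _ _).sub (hL r le_rfl).aestronglyMeasurable)
      (hL r le_rfl).aestronglyMeasurable (by norm_num)
  have ht : Filter.Tendsto (fun n =>
      c * (eLpNorm (fourierPartial (G r) (ns n) - G r) 2 perMeasure
        + eLpNorm (G r) 2 perMeasure)) Filter.atTop
      (nhds (c * (0 + eLpNorm (G r) 2 perMeasure))) := by
    refine ENNReal.Tendsto.const_mul ?_ (Or.inr hc)
    exact ((tendsto_fourierPartial (hL r le_rfl)).comp hns.tendsto_atTop).add tendsto_const_nhds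
  rw [zero_add] at ht
  rw [← ht.liminf_eq]
  exact Filter.liminf_le_liminf (Filter.Eventually.of_forall hb)

theorem integrable_mul_of_continuous {f g : ℝ → ℝ} (hf : Integrable f perMeasure)
    (hg : Continuous g) : Integrable (fun x => f x * g x) perMeasure := by
  obtain ⟨B, hB⟩ := (isCompact_Icc (a := (0 : ℝ)) (b := 1)).exists_bound_of_continuousOn
    hg.continuousOn
  refine hf.mul_bdd (c := B) hg.aestronglyMeasurable ?_
  filter_upwards [ae_restrict_mem measurableSet_Ioc] with x hx
  exact hB x (Set.Ioc_subset_Icc_self hx)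

theorem HasPerWeakDeriv.sub {k : ℕ} {f₁ g₁ f₂ g₂ : ℝ → ℝ} (h₁ : HasPerWeakDeriv k f₁ g₁)
    (h₂ : HasPerWeakDeriv k f₂ g₂) : HasPerWeakDeriv k (f₁ - f₂) (g₁ - g₂) := by
  refine ⟨h₁.integrable_left.sub h₂.integrable_left, h₁.integrable_right.sub h₂.integrable_right,
    fun ψ hψ hψp => ?_⟩
  have hc := continuous_iteratedDeriv_of_smooth hψ k
  simp only [Pi.sub_apply, sub_mul]
  rw [integral_sub (integrable_mul_of_continuous h₁.integrable_left hc)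
      (integrable_mul_of_continuous h₂.integrable_left hc),
    integral_sub (integrable_mul_of_continuous h₁.integrable_right hψ.continuous)
      (integrable_mul_of_continuous h₂.integrable_right hψ.continuous),
    h₁.integral_eq ψ hψ hψp, h₂.integral_eq ψ hψ hψp, mul_sub]

theorem HasPerWeakDeriv.zero {f : ℝ → ℝ} (h : Integrable f perMeasure) :
    HasPerWeakDeriv 0 f f :=
  ⟨h, h, fun ψ _ _ => by simp⟩

/-- At most three terms occur; rounding three up to four gives the factor `2`. -/
theorem perHNorm_le {j : ℕ} (hj : j ≤ 2) {f : ℝ → ℝ} {G : ℕ → ℝ → ℝ} {a : ℝ≥0∞}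
    (hG : ∀ i ≤ j, HasPerWeakDeriv i f (G i)) (ha : ∀ i ≤ j, eLpNorm (G i) 2 perMeasure ≤ a) :
    perHNorm j f ≤ 2 * a := by
  refine (iInf₂_le G hG).trans ?_
  have h1 : ∑ i ∈ Finset.range (j + 1), eLpNorm (G i) 2 perMeasure ^ 2 ≤ (2 * a) ^ (2 : ℝ) := by
    calc _ ≤ ∑ i ∈ Finset.range (j + 1), a ^ 2 :=
          Finset.sum_le_sum fun i hi =>
            pow_le_pow_left₀ zero_le (ha i (Nat.lt_succ_iff.1 (Finset.mem_range.1 hi))) 2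
      _ = ((j + 1 : ℕ) : ℝ≥0∞) * a ^ 2 := by simp
      _ ≤ ((4 : ℕ) : ℝ≥0∞) * a ^ 2 := by gcongr; omega
      _ = _ := by rw [ENNReal.rpow_ofNat, mul_pow]; norm_num
  refine (ENNReal.rpow_le_rpow h1 (by norm_num)).trans (le_of_eq ?_)
  rw [← ENNReal.rpow_mul]
  norm_num

theorem perWNorm_le {j : ℕ} {f : ℝ → ℝ} {G : ℕ → ℝ → ℝ} {a : ℝ≥0∞}
    (hG : ∀ i ≤ j, HasPerWeakDeriv i f (G i)) (ha : ∀ i ≤ j, eLpNorm (G i) ⊤ perMeasure ≤ a) :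
    perWNorm j f ≤ a :=
  (iInf₂_le G hG).trans (Finset.sup_le fun i hi =>
    ha i (Nat.lt_succ_iff.1 (Finset.mem_range.1 hi)))

theorem eLpNorm_le_sqrt_sum {r i : ℕ} (hi : i ≤ r) (G : ℕ → ℝ → ℝ) :
    eLpNorm (G i) 2 perMeasure ≤
      (∑ i ∈ Finset.range (r + 1), eLpNorm (G i) 2 perMeasure ^ 2) ^ (1 / 2 : ℝ) := by
  rw [one_div, ENNReal.le_rpow_inv_iff (by norm_num), ENNReal.rpow_ofNat]
  exact Finset.single_le_sum (f := fun i => eLpNorm (G i) 2 perMeasure ^ 2)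
    (fun _ _ => zero_le) (Finset.mem_range.2 (Nat.lt_succ_of_le hi))

theorem eLpNorm_two_le_sup {r i : ℕ} (hi : i ≤ r) {G : ℕ → ℝ → ℝ}
    (hG : AEStronglyMeasurable (G i) perMeasure) :
    eLpNorm (G i) 2 perMeasure ≤
      (Finset.range (r + 1)).sup fun i => eLpNorm (G i) ⊤ perMeasure :=
  (eLpNorm_le_eLpNorm_of_exponent_le le_top hG).trans
    (Finset.le_sup (f := fun i => eLpNorm (G i) ⊤ perMeasure)
      (Finset.mem_range.2 (Nat.lt_succ_of_le hi)))

/-- A quasiinterpolant error bound in terms of the `r`-th weak derivative in `L²`. -/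
def QuasiInterpErrorBound (r : ℕ) (φ : ∀ N : ℕ, Fin N → ℝ → ℝ) (K : ℝ) : Prop :=
  ∀ N, 1 ≤ N → ∀ (v : ℝ → ℝ) (G : ℕ → ℝ → ℝ), Function.Periodic v 1 → Continuous v →
    (∀ i ≤ r, HasPerWeakDeriv i v (G i)) → (∀ i ≤ r, MemLp (G i) 2 perMeasure) → ∀ k ≤ 2,
      eLpNorm (iteratedDeriv k (quasiInterp (φ N) v) - G k) 2 perMeasure ≤
        ENNReal.ofReal (K * (1 / (N : ℝ)) ^ (r - k)) * eLpNorm (G r) 2 perMeasure ∧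
      eLpNorm (iteratedDeriv k (quasiInterp (φ N) v) - G k) ⊤ perMeasure ≤
        ENNReal.ofReal (K * (1 / (N : ℝ)) ^ ((r : ℝ) - (k : ℝ) - 1 / 2)) *
          eLpNorm (G r) 2 perMeasure

theorem IsQuasiInterpBasis.exists_errorBound {r : ℕ} (hr : 3 ≤ r)
    {φ : ∀ N : ℕ, Fin N → ℝ → ℝ} (h : IsQuasiInterpBasis r φ) :
    ∃ K, 0 < K ∧ QuasiInterpErrorBound r φ K := by
  obtain ⟨A, hA⟩ := h.optimal_order
  have h1 : ∀ k, ∃ K : ℝ, 0 < K ∧ (k ≤ 2 → ∀ N, 1 ≤ N → ∀ w : ℝ → ℝ, Function.Periodic w 1 →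
      ContDiff ℝ ∞ w →
      eLpNorm (iteratedDeriv k (quasiInterp (φ N) w) - iteratedDeriv k w) 2 perMeasure ≤
        ENNReal.ofReal (K * (1 / (N : ℝ)) ^ (r - k)) * eLpNorm (iteratedDeriv r w) 2 perMeasure ∧
      eLpNorm (iteratedDeriv k (quasiInterp (φ N) w) - iteratedDeriv k w) ⊤ perMeasure ≤
        ENNReal.ofReal (K * (1 / (N : ℝ)) ^ ((r : ℝ) - (k : ℝ) - 1 / 2)) *
          eLpNorm (iteratedDeriv r w) 2 perMeasure) := by
    intro k
    by_cases hk : k ≤ 2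
    · obtain ⟨K, hK, hK'⟩ := exists_smooth_error_bound r k (by omega) A
      exact ⟨K, hK, fun _ N hN w hwp hw =>
        hK' N hN _ (quasiInterp_mem (h.mem hN) w) w hw (hA N hN w hwp hw)⟩
    · exact ⟨1, one_pos, fun h => absurd h hk⟩
  choose K hK hK' using h1
  refine ⟨∑ k ∈ Finset.range 3, K k, Finset.sum_pos (fun k _ => hK k) (by simp),
    fun N hN v G hvp hvc hG hL k hk => ?_⟩
  have hle : K k ≤ ∑ k ∈ Finset.range 3, K k :=
    Finset.single_le_sum (fun j _ => (hK j).le) (Finset.mem_range.2 (by omega))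
  constructor
  · refine (quasiInterp_error_of_smooth (by omega) hN (by omega) (h.mem hN) ENNReal.ofReal_ne_top
      (fun w hwp hw => (hK' k hk N hN w hwp hw).1) hvp hvc hG hL).trans ?_
    gcongr
  · refine (quasiInterp_error_of_smooth (by omega) hN (by omega) (h.mem hN) ENNReal.ofReal_ne_top
      (fun w hwp hw => (hK' k hk N hN w hwp hw).2) hvp hvc hG hL).trans ?_
    gcongr

/-! ### Error estimates, boundedness and positivity -/

theorem hasPerWeakDeriv_quasiInterp {r : ℕ} (hr : 3 ≤ r) {φ : ∀ N : ℕ, Fin N → ℝ → ℝ}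
    (h : IsQuasiInterpBasis r φ) {N : ℕ} (hN : 1 ≤ N) (v : ℝ → ℝ) {k : ℕ} (hk : k ≤ 2) :
    HasPerWeakDeriv k (quasiInterp (φ N) v) (iteratedDeriv k (quasiInterp (φ N) v)) :=
  hasPerWeakDeriv_spline (by omega) hN (quasiInterp_mem (h.mem hN) v) (by omega)

theorem one_div_le_one_of_one_le {N : ℕ} (hN : 1 ≤ N) : 1 / (N : ℝ) ≤ 1 := by
  rw [div_le_one (by exact_mod_cast hN)]
  exact_mod_cast hN

theorem perHNorm_error_le {r : ℕ} (hr : 3 ≤ r) {φ : ∀ N : ℕ, Fin N → ℝ → ℝ}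
    (h : IsQuasiInterpBasis r φ) {K : ℝ} (hK : 0 < K) (hE : QuasiInterpErrorBound r φ K)
    {v : ℝ → ℝ} (hv : MemHperWinf r v) {N : ℕ} (hN : 1 ≤ N) {j : ℕ} (hj : j ≤ 2) :
    perHNorm j (quasiInterp (φ N) v - v) ≤
      ENNReal.ofReal (2 * K * (1 / (N : ℝ)) ^ (r - j)) * perHNorm r v := by
  have hh : (0 : ℝ) < 1 / (N : ℝ) := by positivity
  have hc0 : ENNReal.ofReal (2 * K * (1 / (N : ℝ)) ^ (r - j)) ≠ 0 := by
    rw [Ne, ENNReal.ofReal_eq_zero, not_le]; positivity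
  conv_rhs => rw [perHNorm]
  -- A nonzero finite factor passes through the infimum, so one choice of weak derivatives can be
  -- treated at a time.
  simp only [ENNReal.mul_iInf_of_ne hc0 ENNReal.ofReal_ne_top]
  refine le_iInf₂ fun G hG => ?_
  by_cases htop : (∑ i ∈ Finset.range (r + 1), eLpNorm (G i) 2 perMeasure ^ 2) ^ (1 / 2 : ℝ) = ⊤
  · rw [htop, ENNReal.mul_top hc0]
    exact le_top
  have hL : ∀ i ≤ r, MemLp (G i) 2 perMeasure := fun i hi =>
    ⟨(hG i hi).integrable_right.aestronglyMeasurable,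
      (eLpNorm_le_sqrt_sum hi G).trans_lt (lt_top_iff_ne_top.2 htop)⟩
  refine (perHNorm_le hj (a := ENNReal.ofReal (K * (1 / (N : ℝ)) ^ (r - j)) *
      eLpNorm (G r) 2 perMeasure)
    (fun i hi => (hasPerWeakDeriv_quasiInterp hr h hN v (hi.trans hj)).sub (hG i (by omega)))
    fun i hi => ?_).trans ?_
  · refine (hE N hN v G hv.periodic hv.continuous hG hL i (hi.trans hj)).1.trans ?_
    gcongr ENNReal.ofReal (K * ?_) * _
    exact pow_le_pow_of_le_one hh.le (one_div_le_one_of_one_le hN) (by omega)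
  · have h2 : ∀ y : ℝ, 2 * ENNReal.ofReal y = ENNReal.ofReal (2 * y) := fun y => by
      rw [ENNReal.ofReal_mul (by norm_num)]; simp
    rw [← mul_assoc, h2, mul_assoc 2 K]
    gcongr
    exact eLpNorm_le_sqrt_sum le_rfl G

/-- On a probability space the `L²` norm of the `r`-th derivative is at most its `L^∞` norm. Orders
`i ≤ j` carry higher powers of `h ≤ 1`. -/
theorem perWNorm_error_le {r : ℕ} (hr : 3 ≤ r) {φ : ∀ N : ℕ, Fin N → ℝ → ℝ}
    (h : IsQuasiInterpBasis r φ) {K : ℝ} (hK : 0 < K) (hE : QuasiInterpErrorBound r φ K)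
    {v : ℝ → ℝ} (hv : MemHperWinf r v) {N : ℕ} (hN : 1 ≤ N) {j : ℕ} (hj : j ≤ 2) :
    perWNorm j (quasiInterp (φ N) v - v) ≤
      ENNReal.ofReal (2 * K * (1 / (N : ℝ)) ^ ((r : ℝ) - (j : ℝ) - 1 / 2)) * perWNorm r v := by
  have hh : (0 : ℝ) < 1 / (N : ℝ) := by positivity
  have hc0 : ENNReal.ofReal (2 * K * (1 / (N : ℝ)) ^ ((r : ℝ) - (j : ℝ) - 1 / 2)) ≠ 0 := by
    rw [Ne, ENNReal.ofReal_eq_zero, not_le]; positivity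
  conv_rhs => rw [perWNorm]
  simp only [ENNReal.mul_iInf_of_ne hc0 ENNReal.ofReal_ne_top]
  refine le_iInf₂ fun G hG => ?_
  by_cases htop : ((Finset.range (r + 1)).sup fun i => eLpNorm (G i) ⊤ perMeasure) = ⊤
  · rw [htop, ENNReal.mul_top hc0]
    exact le_top
  have hm : ∀ i ≤ r, AEStronglyMeasurable (G i) perMeasure := fun i hi =>
    (hG i hi).integrable_right.aestronglyMeasurable
  have hL : ∀ i ≤ r, MemLp (G i) 2 perMeasure := fun i hi =>
    ⟨hm i hi, (eLpNorm_two_le_sup hi (hm i hi)).trans_lt (lt_top_iff_ne_top.2 htop)⟩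
  refine perWNorm_le
    (fun i hi => (hasPerWeakDeriv_quasiInterp hr h hN v (hi.trans hj)).sub (hG i (by omega)))
    fun i hi => ?_
  refine (hE N hN v G hv.periodic hv.continuous hG hL i (hi.trans hj)).2.trans ?_
  refine mul_le_mul' (ENNReal.ofReal_le_ofReal ?_) (eLpNorm_two_le_sup le_rfl (hm r le_rfl))
  have hij : (i : ℝ) ≤ j := by exact_mod_cast hi
  refine mul_le_mul (by linarith) ?_ (by positivity) (by positivity)
  exact Real.rpow_le_rpow_of_exponent_ge hh (one_div_le_one_of_one_le hN) (by linarith)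

theorem memLp_perMeasure_of_continuous {f : ℝ → ℝ} (hf : Continuous f) (p : ℝ≥0∞) :
    MemLp f p perMeasure := by
  obtain ⟨B, hB⟩ := (isCompact_Icc (a := (0 : ℝ)) (b := 1)).exists_bound_of_continuousOn
    hf.continuousOn
  refine MemLp.of_bound hf.aestronglyMeasurable B ?_
  filter_upwards [ae_restrict_mem measurableSet_Ioc] with x hx
  exact hB x (Set.Ioc_subset_Icc_self hx)

/-- Requiring `G 0 = v` exactly, not just almost everywhere, lets the sup estimate of order `0` be
read as one for a continuous function. -/
theorem MemHperWinf.exists_weakDeriv {r : ℕ} {v : ℝ → ℝ} (hv : MemHperWinf r v) :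
    ∃ G : ℕ → ℝ → ℝ, G 0 = v ∧ (∀ i ≤ r, HasPerWeakDeriv i v (G i)) ∧
      ∀ i ≤ r, MemLp (G i) ⊤ perMeasure := by
  have h := hv.wNorm_lt_top
  rw [perWNorm, iInf_lt_iff] at h
  obtain ⟨G, h⟩ := h
  rw [iInf_lt_iff] at h
  obtain ⟨hG, h⟩ := h
  have hL : ∀ i ≤ r, MemLp (G i) ⊤ perMeasure := fun i hi =>
    ⟨(hG i hi).integrable_right.aestronglyMeasurable,
      (Finset.le_sup (f := fun i => eLpNorm (G i) ⊤ perMeasure)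
        (Finset.mem_range.2 (Nat.lt_succ_of_le hi))).trans_lt h⟩
  refine ⟨Function.update G 0 v, by simp, fun i hi => ?_, fun i hi => ?_⟩
  · rcases eq_or_ne i 0 with rfl | h0
    · simpa using HasPerWeakDeriv.zero
        ((memLp_perMeasure_of_continuous hv.continuous 1).integrable le_rfl)
    · rw [Function.update_of_ne h0]; exact hG i hi
  · rcases eq_or_ne i 0 with rfl | h0
    · simpa using memLp_perMeasure_of_continuous hv.continuous ⊤
    · rw [Function.update_of_ne h0]; exact hL i hi

theorem quasiInterp_norms_bounded {r : ℕ} (hr : 3 ≤ r) {φ : ∀ N : ℕ, Fin N → ℝ → ℝ}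
    (h : IsQuasiInterpBasis r φ) {K : ℝ} (hK : 0 < K) (hE : QuasiInterpErrorBound r φ K)
    {v : ℝ → ℝ} (hv : MemHperWinf r v) :
    ∃ C : ℝ, ∀ N : ℕ, 1 ≤ N → ∀ j ≤ 2,
      perHNorm j (quasiInterp (φ N) v) ≤ ENNReal.ofReal C ∧
      perWNorm j (quasiInterp (φ N) v) ≤ ENNReal.ofReal C := by
  obtain ⟨G, -, hG, hL⟩ := hv.exists_weakDeriv
  have hL2 : ∀ i ≤ r, MemLp (G i) 2 perMeasure := fun i hi => (hL i hi).mono_exponent le_top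
  set a : ℝ≥0∞ := ENNReal.ofReal K * eLpNorm (G r) 2 perMeasure +
    ∑ i ∈ Finset.range 3, eLpNorm (G i) ⊤ perMeasure with ha
  have hfin : a ≠ ⊤ := by
    refine ENNReal.add_ne_top.2 ⟨ENNReal.mul_ne_top ENNReal.ofReal_ne_top
      (hL2 r le_rfl).eLpNorm_ne_top, ENNReal.sum_ne_top.2 fun i hi => ?_⟩
    exact (hL i (by have := Finset.mem_range.1 hi; omega)).eLpNorm_ne_top
  have key : ∀ p : ℝ≥0∞, 1 ≤ p → (∀ N : ℕ, 1 ≤ N → ∀ k ≤ 2,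
      eLpNorm (iteratedDeriv k (quasiInterp (φ N) v) - G k) p perMeasure ≤
        ENNReal.ofReal K * eLpNorm (G r) 2 perMeasure) → ∀ N : ℕ, 1 ≤ N → ∀ k ≤ 2,
      eLpNorm (iteratedDeriv k (quasiInterp (φ N) v)) p perMeasure ≤ a := by
    intro p hp hb N hN k hk
    have hGm := (hG k (by omega)).integrable_right.aestronglyMeasurable
    have hQm := (memLp_iteratedDeriv_spline hN (quasiInterp_mem (h.mem hN) v) k
      2).aestronglyMeasurable
    rw [← sub_add_cancel (iteratedDeriv k (quasiInterp (φ N) v)) (G k)]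
    refine (eLpNorm_add_le (hQm.sub hGm) hGm hp).trans (add_le_add (hb N hN k hk) ?_)
    refine (eLpNorm_le_eLpNorm_of_exponent_le le_top hGm).trans ?_
    exact Finset.single_le_sum (f := fun i => eLpNorm (G i) ⊤ perMeasure) (fun _ _ => zero_le)
      (Finset.mem_range.2 (by omega))
  have hone : ∀ N : ℕ, 1 ≤ N → (0 : ℝ) ≤ 1 / (N : ℝ) := fun N _ => by positivity
  have h2 := key 2 (by norm_num) fun N hN k hk => by
    refine (hE N hN v G hv.periodic hv.continuous hG hL2 k hk).1.trans ?_
    gcongr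
    exact mul_le_of_le_one_right hK.le (pow_le_one₀ (hone N hN) (one_div_le_one_of_one_le hN))
  have htop := key ⊤ le_top fun N hN k hk => by
    refine (hE N hN v G hv.periodic hv.continuous hG hL2 k hk).2.trans ?_
    gcongr
    refine mul_le_of_le_one_right hK.le
      (Real.rpow_le_one (hone N hN) (one_div_le_one_of_one_le hN) ?_)
    have h3 : (3 : ℝ) ≤ r := by exact_mod_cast hr
    have h4 : (k : ℝ) ≤ 2 := by exact_mod_cast hk
    linarith
  refine ⟨(2 * a).toReal, fun N hN j hj => ?_⟩
  rw [ENNReal.ofReal_toReal (ENNReal.mul_ne_top (by norm_num) hfin)]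
  refine ⟨perHNorm_le hj (fun i hi => hasPerWeakDeriv_quasiInterp hr h hN v (hi.trans hj))
    fun i hi => h2 N hN i (hi.trans hj), ?_⟩
  refine (perWNorm_le (fun i hi => hasPerWeakDeriv_quasiInterp hr h hN v (hi.trans hj))
    fun i hi => htop N hN i (hi.trans hj)).trans ?_
  exact le_mul_of_one_le_left zero_le (by norm_num)

/-- The exceptional set in `(0, 1)` is open and null, hence empty; the endpoints follow by closure.
-/
theorem abs_le_of_eLpNorm_top_le {f : ℝ → ℝ} (hf : Continuous f) {ε : ℝ} (hε : 0 ≤ ε)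
    (h : eLpNorm f ⊤ perMeasure ≤ ENNReal.ofReal ε) : ∀ x ∈ Set.Icc (0 : ℝ) 1, |f x| ≤ ε := by
  have hae : ∀ᵐ x ∂(volume.restrict (Set.Ioo (0 : ℝ) 1)), |f x| ≤ ε := by
    rw [restrict_Ioo_eq_restrict_Ioc]
    have h1 := ae_le_eLpNormEssSup (f := f) (μ := perMeasure)
    rw [← eLpNorm_exponent_top] at h1
    filter_upwards [h1] with x hx
    have := hx.trans h
    rwa [Real.enorm_eq_ofReal_abs, ENNReal.ofReal_le_ofReal_iff hε] at this
  have hopen : IsOpen (Set.Ioo (0 : ℝ) 1 ∩ {x | ε < |f x|}) :=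
    isOpen_Ioo.inter (isOpen_lt continuous_const hf.abs)
  have hnull : volume (Set.Ioo (0 : ℝ) 1 ∩ {x | ε < |f x|}) = 0 := by
    rw [ae_restrict_iff' measurableSet_Ioo] at hae
    refine measure_mono_null ?_ (ae_iff.1 hae)
    rintro x ⟨hx1, hx2⟩ hx3
    exact absurd (hx3 hx1) (not_le.2 hx2)
  have hempty := hopen.measure_eq_zero_iff volume |>.1 hnull
  have hsub : Set.Ioo (0 : ℝ) 1 ⊆ {x | |f x| ≤ ε} := fun x hx => by
    by_contra hx'
    have : x ∈ Set.Ioo (0 : ℝ) 1 ∩ {x | ε < |f x|} := ⟨hx, by simpa using hx'⟩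
    rw [hempty] at this
    exact this
  have hcl := closure_minimal hsub (isClosed_le hf.abs continuous_const)
  rwa [closure_Ioo zero_ne_one] at hcl

theorem quasiInterp_lower_bound {r : ℕ} (hr : 3 ≤ r) {φ : ∀ N : ℕ, Fin N → ℝ → ℝ}
    (h : IsQuasiInterpBasis r φ) {K : ℝ} (hK : 0 < K) (hE : QuasiInterpErrorBound r φ K)
    {v : ℝ → ℝ} (hv : MemHperWinf r v) {c₀ : ℝ} (hc₀ : 0 < c₀)
    (hvc : ∀ x ∈ Set.Icc (0 : ℝ) 1, c₀ ≤ v x) :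
    ∃ h₀ : ℝ, 0 < h₀ ∧ ∀ N : ℕ, 1 ≤ N → 1 / (N : ℝ) ≤ h₀ →
      ∀ x ∈ Set.Icc (0 : ℝ) 1, c₀ / 2 ≤ quasiInterp (φ N) v x := by
  obtain ⟨G, hG0, hG, hL⟩ := hv.exists_weakDeriv
  have hL2 : ∀ i ≤ r, MemLp (G i) 2 perMeasure := fun i hi => (hL i hi).mono_exponent le_top
  set g := (eLpNorm (G r) 2 perMeasure).toReal with hg
  have hg0 : 0 ≤ g := ENNReal.toReal_nonneg
  have hgE : eLpNorm (G r) 2 perMeasure = ENNReal.ofReal g :=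
    (ENNReal.ofReal_toReal (hL2 r le_rfl).eLpNorm_ne_top).symm
  -- The uniform error is at most `K h^(r-1/2) g ≤ K h (g + 1)`, which this threshold makes at most
  -- `c₀ / 2`. The `+ 1` covers `g = 0`.
  refine ⟨c₀ / (2 * K * (g + 1)), by positivity, fun N hN hNh x hx => ?_⟩
  have hh : (0 : ℝ) < 1 / (N : ℝ) := by positivity
  have h1 := (hE N hN v G hv.periodic hv.continuous hG hL2 0 (by norm_num)).2
  rw [iteratedDeriv_zero, hG0, hgE, ← ENNReal.ofReal_mul (by positivity)] at h1
  have hQc : Continuous (quasiInterp (φ N) v) := continuous_spline (quasiInterp_mem (h.mem hN) v)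
  have h2 := abs_le_of_eLpNorm_top_le (hQc.sub hv.continuous) (by positivity) h1 x hx
  have h3 : (1 / (N : ℝ)) ^ ((r : ℝ) - ((0 : ℕ) : ℝ) - 1 / 2) ≤ 1 / (N : ℝ) := by
    have h4 : (3 : ℝ) ≤ r := by exact_mod_cast hr
    have := Real.rpow_le_rpow_of_exponent_ge hh (one_div_le_one_of_one_le hN)
      (show (1 : ℝ) ≤ (r : ℝ) - ((0 : ℕ) : ℝ) - 1 / 2 by push_cast; linarith)
    rwa [Real.rpow_one] at this
  have h5 : K * (1 / (N : ℝ)) ^ ((r : ℝ) - ((0 : ℕ) : ℝ) - 1 / 2) * g ≤ c₀ / 2 := by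
    calc K * (1 / (N : ℝ)) ^ ((r : ℝ) - ((0 : ℕ) : ℝ) - 1 / 2) * g
        ≤ K * (c₀ / (2 * K * (g + 1))) * (g + 1) := by
          gcongr
          · exact h3.trans hNh
          · linarith
      _ = c₀ / 2 := by field_simp
  have h6 := (abs_le.1 (h2.trans h5)).1
  rw [Pi.sub_apply] at h6
  linarith [hvc x hx]

/-! ### Polynomials in the shift operator -/

section Shift

variable {α : Type*} [AddCommGroupWithOne α]

/-- The shift `f ↦ f (· - 1)`. -/
def shiftEnd (α : Type*) [AddCommGroupWithOne α] : Module.End ℝ (α → ℝ) :=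
  LinearMap.funLeft ℝ ℝ fun y => y - 1

theorem shiftEnd_pow_apply (k : ℕ) (f : α → ℝ) (y : α) : (shiftEnd α ^ k) f y = f (y - k) := by
  induction k generalizing y with
  | zero => simp
  | succ k ih =>
    rw [pow_succ', Module.End.mul_apply]
    change (shiftEnd α ^ k) f (y - 1) = _
    rw [ih]
    congr 1
    push_cast
    abel

theorem aeval_shiftEnd_apply {P : Polynomial ℝ} {n : ℕ} (hn : P.natDegree < n) (f : α → ℝ)
    (y : α) : Polynomial.aeval (shiftEnd α) P f y
      = ∑ k ∈ Finset.range n, P.coeff k * f (y - k) := by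
  rw [Polynomial.aeval_eq_sum_range' hn, LinearMap.sum_apply, Finset.sum_apply]
  simp [shiftEnd_pow_apply]

theorem aeval_shiftEnd_X_sub_one_pow (n : ℕ) (f : ℝ → ℝ) (y : ℝ) :
    Polynomial.aeval (shiftEnd ℝ) ((Polynomial.X - 1 : Polynomial ℝ) ^ n) f y
      = (-1) ^ n * ((fwdDiff 1)^[n] f) (y - n) := by
  induction n generalizing y with
  | zero => simp
  | succ n ih =>
    rw [pow_succ', map_mul, Module.End.mul_apply]
    have h : ∀ g : ℝ → ℝ, Polynomial.aeval (shiftEnd ℝ) (Polynomial.X - 1 : Polynomial ℝ) g y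
        = g (y - 1) - g y := by
      intro g
      simp only [map_sub, Polynomial.aeval_X, map_one, LinearMap.sub_apply, Pi.sub_apply,
        Module.End.one_apply]
      rfl
    rw [h, ih, ih, Function.iterate_succ_apply', fwdDiff]
    have e1 : y - ((n + 1 : ℕ) : ℝ) + 1 = y - n := by push_cast; ring
    have e2 : y - 1 - (n : ℝ) = y - ((n + 1 : ℕ) : ℝ) := by push_cast; ring
    rw [e1, e2]
    ring

theorem natDegree_lt_of_mem_degreeLT {r : ℕ} (hr : 0 < r) {q : Polynomial ℝ}
    (hq : q ∈ Polynomial.degreeLT ℝ r) : q.natDegree < r := by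
  by_cases h0 : q = 0
  · simpa [h0] using hr
  · rw [Polynomial.mem_degreeLT, Polynomial.degree_eq_natDegree h0] at hq
    exact_mod_cast hq

/-- Up to sign and translation, `(X - 1)^r` acts as the `r`-th forward difference. -/
theorem aeval_shiftEnd_polynomial_eq_zero {r : ℕ} (hr : 0 < r) {P q : Polynomial ℝ}
    (hP : (Polynomial.X - 1) ^ r ∣ P) (hq : q ∈ Polynomial.degreeLT ℝ r) :
    Polynomial.aeval (shiftEnd ℝ) P (fun x => q.eval x) = 0 := by
  obtain ⟨a, rfl⟩ := hP
  rw [mul_comm, map_mul, Module.End.mul_apply]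
  have : Polynomial.aeval (shiftEnd ℝ) ((Polynomial.X - 1 : Polynomial ℝ) ^ r) (fun x => q.eval x) = 0 := by
    funext y
    rw [aeval_shiftEnd_X_sub_one_pow,
      Polynomial.fwdDiff_iter_eq_zero_of_degree_lt (natDegree_lt_of_mem_degreeLT hr hq)]
    simp
  rw [this, map_zero]

theorem aeval_shiftEnd_int (P : Polynomial ℝ) (f : ℝ → ℝ) (n : ℤ) :
    Polynomial.aeval (shiftEnd ℤ) P (fun k : ℤ => f k) n
      = Polynomial.aeval (shiftEnd ℝ) P f n := by
  rw [aeval_shiftEnd_apply (Nat.lt_succ_self _), aeval_shiftEnd_apply (Nat.lt_succ_self _)]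
  simp

theorem aeval_shiftEnd_int_polynomial_eq_zero {r : ℕ} (hr : 0 < r) {P q : Polynomial ℝ}
    (hP : (Polynomial.X - 1) ^ r ∣ P) (hq : q ∈ Polynomial.degreeLT ℝ r) :
    Polynomial.aeval (shiftEnd ℤ) P (fun k : ℤ => q.eval (k : ℝ)) = 0 := by
  funext n
  rw [aeval_shiftEnd_int P (fun x => q.eval x), aeval_shiftEnd_polynomial_eq_zero hr hP hq]
  simp

/-- A periodic sequence annihilated by a mask without further zeros at roots of unity is
constant. -/
theorem periodic_eq_of_aeval_shiftEnd_eq_zero {r N : ℕ} (hr : 0 < r) (hN : 1 ≤ N)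
    {a : Polynomial ℝ} (ha : ∀ z : ℂ, z ^ N = 1 → Polynomial.aeval z a ≠ 0) {c : ℤ → ℝ}
    (hc : ∀ k, c (k - N) = c k)
    (h0 : Polynomial.aeval (shiftEnd ℤ) (a * (Polynomial.X - 1) ^ r) c = 0) :
    ∀ k, c k = c 0 := by
  set g : Polynomial ℝ := ∑ i ∈ Finset.range N, Polynomial.X ^ i with hg
  have hgX : (Polynomial.X - 1) * g = Polynomial.X ^ N - 1 := by
    rw [hg, mul_geom_sum]
  have h1 : IsCoprime a g := by
    have : IsCoprime a (Polynomial.X ^ N - 1) := by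
      refine (Polynomial.isCoprime_iff_aeval_ne_zero_of_isAlgClosed ℝ ℂ a _).2 fun z => ?_
      by_cases hz : z ^ N = 1
      · exact Or.inl (ha z hz)
      · right
        simpa [sub_eq_zero] using hz
    rw [← hgX] at this
    exact this.of_mul_right_right
  have h2 : IsCoprime (Polynomial.X - 1 : Polynomial ℝ) g := by
    rw [← Polynomial.C_1, (Polynomial.irreducible_X_sub_C (1 : ℝ)).coprime_iff_not_dvd,
      Polynomial.dvd_iff_isRoot]
    have : N ≠ 0 := by omega
    simpa [hg, Polynomial.eval_finsetSum] using this
  -- With `g = (X^N - 1) / (X - 1)` prime to `a (X - 1)^(r-1)`, Bézout times `X - 1` puts `X - 1` in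
  -- the ideal of `a (X - 1)^r` and `X^N - 1`. Both of these annihilate `c`.
  obtain ⟨u, w, huw⟩ := h1.mul_left (h2.pow_left (m := r - 1))
  have h3 : u * (a * (Polynomial.X - 1) ^ r) + w * (Polynomial.X ^ N - 1) = Polynomial.X - 1 := by
    rw [← hgX]
    have e : (Polynomial.X - 1 : Polynomial ℝ) ^ r
        = (Polynomial.X - 1) ^ (r - 1) * (Polynomial.X - 1) := by
      rw [← pow_succ, Nat.sub_add_cancel hr]
    rw [e]
    linear_combination (Polynomial.X - 1) * huw
  have h4 : Polynomial.aeval (shiftEnd ℤ) (Polynomial.X ^ N - 1 : Polynomial ℝ) c = 0 := by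
    funext k
    simp only [map_sub, map_pow, Polynomial.aeval_X, map_one, LinearMap.sub_apply, Pi.sub_apply,
      Module.End.one_apply, shiftEnd_pow_apply, Pi.zero_apply]
    rw [hc, sub_self]
  have h5 : Polynomial.aeval (shiftEnd ℤ) (Polynomial.X - 1 : Polynomial ℝ) c = 0 := by
    rw [← h3, map_add, map_mul _ u, map_mul _ w, LinearMap.add_apply, Module.End.mul_apply,
      Module.End.mul_apply, h0, h4, map_zero, map_zero, add_zero]
  have h6 : ∀ k, c (k - 1) = c k := by
    intro k
    have := congrFun h5 k
    simp only [map_sub, Polynomial.aeval_X, map_one, LinearMap.sub_apply, Pi.sub_apply,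
      Module.End.one_apply, Pi.zero_apply, sub_eq_zero] at this
    exact this
  intro k
  induction k using Int.induction_on with
  | zero => rfl
  | succ i ih => rw [← ih, ← h6 (i + 1), add_sub_cancel_right]
  | pred i ih => rw [h6, ih]

end Shift

/-! ### The compactly supported kernel and the choice of its mask -/

section Kernel

/-- The truncated power `x₊^(r-1)`. -/
def truncPow (r : ℕ) (x : ℝ) : ℝ := max x 0 ^ (r - 1)

theorem truncPow_of_nonneg {r : ℕ} {x : ℝ} (hx : 0 ≤ x) : truncPow r x = x ^ (r - 1) := by
  rw [truncPow, max_eq_left hx]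

theorem truncPow_of_nonpos {r : ℕ} (hr : 2 ≤ r) {x : ℝ} (hx : x ≤ 0) : truncPow r x = 0 := by
  rw [truncPow, max_eq_right hx, zero_pow (by omega)]

theorem hasDerivAt_max_pow (m : ℕ) (x : ℝ) :
    HasDerivAt (fun y : ℝ => max y 0 ^ (m + 2)) (((m + 2 : ℕ) : ℝ) * max x 0 ^ (m + 1)) x := by
  have hne : ∀ y : ℝ, y ≠ 0 →
      HasDerivAt (fun y : ℝ => max y 0 ^ (m + 2)) (((m + 2 : ℕ) : ℝ) * max y 0 ^ (m + 1)) y := by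
    intro y hy
    rcases lt_or_gt_of_ne hy with h | h
    · have h1 : (fun y : ℝ => max y 0 ^ (m + 2)) =ᶠ[nhds y] fun _ => 0 := by
        filter_upwards [isOpen_Iio.mem_nhds h] with z hz
        rw [max_eq_right (le_of_lt hz), zero_pow (by omega)]
      rw [max_eq_right h.le, zero_pow (by omega), mul_zero]
      exact (hasDerivAt_const y (0 : ℝ)).congr_of_eventuallyEq h1
    · have h1 : (fun y : ℝ => max y 0 ^ (m + 2)) =ᶠ[nhds y] fun y => y ^ (m + 2) := by
        filter_upwards [isOpen_Ioi.mem_nhds h] with z hz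
        rw [max_eq_left (le_of_lt hz)]
      rw [max_eq_left (le_of_lt h)]
      exact (hasDerivAt_pow (m + 2) y).congr_of_eventuallyEq h1
  exact hasDerivAt_of_hasDerivAt_of_ne' hne (by fun_prop)
    (g := fun y : ℝ => ((m + 2 : ℕ) : ℝ) * max y 0 ^ (m + 1)) (by fun_prop) x

theorem contDiff_max_pow (m : ℕ) : ContDiff ℝ m fun y : ℝ => max y 0 ^ (m + 1) := by
  induction m with
  | zero =>
    rw [Nat.cast_zero, contDiff_zero]
    fun_prop
  | succ m ih =>
    have hd : deriv (fun y : ℝ => max y 0 ^ (m + 1 + 1))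
        = fun x => ((m + 2 : ℕ) : ℝ) * max x 0 ^ (m + 1) :=
      funext fun x => (hasDerivAt_max_pow m x).deriv
    rw [show ((m + 1 : ℕ) : ℕ∞ω) = (m : ℕ∞ω) + 1 by push_cast; rfl, contDiff_succ_iff_deriv]
    refine ⟨fun x => (hasDerivAt_max_pow m x).differentiableAt, fun h => absurd h (by simp), ?_⟩
    rw [hd]
    exact contDiff_const.mul ih

theorem contDiff_truncPow {r : ℕ} (hr : 2 ≤ r) : ContDiff ℝ ((r - 2 : ℕ) : ℕ∞) (truncPow r) := by
  have := contDiff_max_pow (r - 2)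
  rw [show r - 2 + 1 = r - 1 by omega] at this
  exact this

/-- The compactly supported spline with mask `β`. -/
noncomputable def maskSpline (r : ℕ) (β : Polynomial ℝ) (x : ℝ) : ℝ :=
  ∑ l ∈ Finset.range (β.natDegree + 1), β.coeff l * truncPow r (x - l)

theorem maskSpline_of_nonpos {r : ℕ} (hr : 2 ≤ r) (β : Polynomial ℝ) {x : ℝ} (hx : x ≤ 0) :
    maskSpline r β x = 0 := by
  refine Finset.sum_eq_zero fun l _ => ?_
  have : (0 : ℝ) ≤ l := by positivity
  rw [truncPow_of_nonpos hr (by linarith), mul_zero]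

theorem X_pow_mem_degreeLT {r m : ℕ} (h : m < r) :
    (Polynomial.X ^ m : Polynomial ℝ) ∈ Polynomial.degreeLT ℝ r := by
  rw [Polynomial.mem_degreeLT, Polynomial.degree_X_pow]
  exact_mod_cast h

/-- To the right of all knots the truncated powers are ordinary ones, and the mask annihilates
polynomials of degree `r - 1`. -/
theorem maskSpline_of_natDegree_le {r : ℕ} (hr : 2 ≤ r) {β : Polynomial ℝ}
    (hβ : (Polynomial.X - 1) ^ r ∣ β) {x : ℝ} (hx : β.natDegree ≤ x) :
    maskSpline r β x = 0 := by
  have h := congrFun (aeval_shiftEnd_polynomial_eq_zero (by omega) hβ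
    (X_pow_mem_degreeLT (r := r) (m := r - 1) (by omega))) x
  rw [aeval_shiftEnd_apply (Nat.lt_succ_self _)] at h
  rw [maskSpline, Pi.zero_apply] at *
  rw [← h]
  refine Finset.sum_congr rfl fun l hl => ?_
  have : (l : ℝ) ≤ β.natDegree := by
    exact_mod_cast Nat.lt_succ_iff.1 (Finset.mem_range.1 hl)
  rw [truncPow_of_nonneg (by linarith)]
  simp

theorem contDiff_maskSpline {r : ℕ} (hr : 2 ≤ r) (β : Polynomial ℝ) :
    ContDiff ℝ ((r - 2 : ℕ) : ℕ∞) (maskSpline r β) :=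
  ContDiff.sum fun _ _ => contDiff_const.mul ((contDiff_truncPow hr).comp (by fun_prop))

theorem exists_bound_maskSpline {r : ℕ} (hr : 2 ≤ r) {β : Polynomial ℝ}
    (hβ : (Polynomial.X - 1) ^ r ∣ β) : ∃ B : ℝ, 0 ≤ B ∧ ∀ x, |maskSpline r β x| ≤ B := by
  obtain ⟨B, hB⟩ := (isCompact_Icc (a := (0 : ℝ)) (b := β.natDegree)).exists_bound_of_continuousOn
    (contDiff_maskSpline hr β).continuous.continuousOn
  refine ⟨max B 0, le_max_right _ _, fun x => ?_⟩
  rcases le_or_gt x 0 with h | h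
  · simp [maskSpline_of_nonpos hr β h]
  rcases le_or_gt (β.natDegree : ℝ) x with h' | h'
  · simp [maskSpline_of_natDegree_le hr hβ h']
  · exact (hB x ⟨h.le, h'.le⟩).trans (le_max_left _ _)

/-- The values of the kernel at the integers, as a polynomial. -/
noncomputable def maskSymbol (r : ℕ) (β : Polynomial ℝ) : Polynomial ℝ :=
  ∑ m ∈ Finset.range (β.natDegree + 1), Polynomial.monomial m (maskSpline r β m)

/-- Sampling the kernel at integers is a convolution with the mask. As power series this shows that
multiplying the mask by `a` multiplies the symbol by `a`. -/
theorem coe_maskSymbol {r : ℕ} (hr : 2 ≤ r) {β : Polynomial ℝ}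
    (hβ : (Polynomial.X - 1) ^ r ∣ β) :
    (maskSymbol r β : PowerSeries ℝ) = β * PowerSeries.mk fun m : ℕ => truncPow r m := by
  ext m
  rw [Polynomial.coeff_coe, PowerSeries.coeff_mul]
  have h1 : (maskSymbol r β).coeff m = maskSpline r β m := by
    simp only [maskSymbol, Polynomial.finsetSum_coeff, Polynomial.coeff_monomial,
      Finset.sum_ite_eq', Finset.mem_range]
    split_ifs with h
    · rfl
    · exact (maskSpline_of_natDegree_le hr hβ (by exact_mod_cast (by omega))).symm
  rw [h1, maskSpline, Finset.Nat.sum_antidiagonal_eq_sum_range_succ_mk]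
  simp only [Polynomial.coeff_coe, PowerSeries.coeff_mk]
  have hz : ∀ l : ℕ, β.natDegree < l → β.coeff l = 0 := fun l hl =>
    Polynomial.coeff_eq_zero_of_natDegree_lt hl
  have hL : ∑ l ∈ Finset.range (β.natDegree + 1), β.coeff l * truncPow r ((m : ℝ) - l)
      = ∑ l ∈ Finset.range (β.natDegree + m + 1), β.coeff l * truncPow r ((m : ℝ) - l) := by
    refine Finset.sum_subset (fun l hl => ?_) fun l _ hl => ?_
    · rw [Finset.mem_range] at *; omega
    · rw [Finset.mem_range] at hl
      rw [hz l (by omega), zero_mul]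
  rw [hL]
  symm
  have hR : ∑ l ∈ Finset.range m.succ, β.coeff l * truncPow r ((m - l : ℕ) : ℝ)
      = ∑ l ∈ Finset.range m.succ, β.coeff l * truncPow r ((m : ℝ) - l) := by
    refine Finset.sum_congr rfl fun l hl => ?_
    rw [Nat.cast_sub (Nat.lt_succ_iff.1 (Finset.mem_range.1 hl))]
  rw [hR]
  refine Finset.sum_subset (fun l hl => ?_) fun l _ hl => ?_
  · rw [Finset.mem_range] at *; omega
  · rw [Finset.mem_range] at hl
    have : (m : ℝ) ≤ l := by exact_mod_cast (by omega)
    rw [truncPow_of_nonpos hr (by linarith), mul_zero]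

/-- If the value were zero, cancelling `X - 1` would make `(X - 1)^(r-1) ∑ m^(r-1) X^m` a
polynomial. Its high coefficients are differences of order `r - 1` of `x^(r-1)`, namely `±(r - 1)!`.
-/
theorem maskSymbol_eval_one_ne_zero {r : ℕ} (hr : 2 ≤ r) :
    (maskSymbol r ((Polynomial.X - 1) ^ r)).eval 1 ≠ 0 := by
  intro h0
  obtain ⟨Q, hQ⟩ := Polynomial.dvd_iff_isRoot.2 h0
  have h1 := coe_maskSymbol hr (dvd_refl ((Polynomial.X - 1 : Polynomial ℝ) ^ r))
  have e : (Polynomial.X - 1 : Polynomial ℝ) ^ r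
      = (Polynomial.X - 1) * (Polynomial.X - 1) ^ (r - 1) := by
    rw [← pow_succ', Nat.sub_add_cancel (by omega)]
  conv_rhs at h1 => rw [e]
  rw [hQ, Polynomial.C_1, Polynomial.coe_mul, Polynomial.coe_mul, mul_assoc] at h1
  have hne : ((Polynomial.X - 1 : Polynomial ℝ) : PowerSeries ℝ) ≠ 0 := by
    rw [Ne, Polynomial.coe_eq_zero_iff]
    exact Polynomial.X_sub_C_ne_zero (1 : ℝ)
  have h2 := mul_left_cancel₀ hne h1
  set m := Q.natDegree + r with hm
  have h3 := congrArg (PowerSeries.coeff m) h2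
  rw [Polynomial.coeff_coe, Polynomial.coeff_eq_zero_of_natDegree_lt (by omega),
    PowerSeries.coeff_mul, Finset.Nat.sum_antidiagonal_eq_sum_range_succ_mk] at h3
  simp only [Polynomial.coeff_coe, PowerSeries.coeff_mk] at h3
  have hdeg : ((Polynomial.X - 1 : Polynomial ℝ) ^ (r - 1)).natDegree < m.succ := by
    have : ((Polynomial.X - 1 : Polynomial ℝ) ^ (r - 1)).natDegree = r - 1 := by
      rw [← Polynomial.C_1, Polynomial.natDegree_pow, Polynomial.natDegree_X_sub_C, mul_one]
    omega
  have h4 : Polynomial.aeval (shiftEnd ℝ) ((Polynomial.X - 1 : Polynomial ℝ) ^ (r - 1))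
      (fun x : ℝ => x ^ (r - 1)) (m : ℝ) = 0 := by
    rw [aeval_shiftEnd_apply hdeg, h3]
    refine Finset.sum_congr rfl fun l hl => ?_
    rw [truncPow_of_nonneg (by positivity),
      Nat.cast_sub (Nat.lt_succ_iff.1 (Finset.mem_range.1 hl))]
  rw [aeval_shiftEnd_X_sub_one_pow, fwdDiff_iter_eq_factorial] at h4
  have : ((r - 1).factorial : ℝ) ≠ 0 := by positivity
  simp at h4
  exact this (by exact_mod_cast h4)

theorem countable_rootsOfUnity : {z : ℂ | ∃ N : ℕ, 1 ≤ N ∧ z ^ N = 1}.Countable := by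
  have h : {z : ℂ | ∃ N : ℕ, 1 ≤ N ∧ z ^ N = 1} ⊆
      ⋃ N : ℕ, (((Polynomial.X ^ (N + 1) - 1 : Polynomial ℂ).roots.toFinset : Finset ℂ) :
        Set ℂ) := by
    rintro z ⟨N, hN, hz⟩
    refine Set.mem_iUnion.2 ⟨N - 1, ?_⟩
    have hne : (Polynomial.X ^ N - 1 : Polynomial ℂ) ≠ 0 := by
      rw [← Polynomial.C_1]
      exact Polynomial.X_pow_sub_C_ne_zero (by omega) 1
    rw [Nat.sub_add_cancel hN, Finset.mem_coe, Multiset.mem_toFinset, Polynomial.mem_roots hne]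
    simp [hz]
  exact (Set.countable_iUnion fun N => (Finset.finite_toSet _).countable).mono h

/-- There is a mask for which the kernel reproduces polynomials of degree less than `r` and which
has no zeros at roots of unity other than the `r`-fold zero at `1`. -/
theorem exists_mask {r : ℕ} (hr : 2 ≤ r) : ∃ a : Polynomial ℝ,
    (Polynomial.X - 1) ^ r ∣ maskSymbol r (a * (Polynomial.X - 1) ^ r) - 1 ∧
    ∀ (N : ℕ) (z : ℂ), 1 ≤ N → z ^ N = 1 → Polynomial.aeval z a ≠ 0 := by
  set Γ := maskSymbol r ((Polynomial.X - 1) ^ r) with hΓ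
  have hcop : IsCoprime Γ ((Polynomial.X - 1) ^ r) := by
    refine IsCoprime.pow_right ?_
    rw [isCoprime_comm, ← Polynomial.C_1,
      (Polynomial.irreducible_X_sub_C (1 : ℝ)).coprime_iff_not_dvd, Polynomial.dvd_iff_isRoot]
    exact maskSymbol_eval_one_ne_zero hr
  obtain ⟨a₀, w, h0⟩ := hcop
  have hcount : ((fun z : ℂ => (-(Polynomial.aeval z a₀) / (z - 1) ^ r).re) ''
      {z : ℂ | ∃ N : ℕ, 1 ≤ N ∧ z ^ N = 1}).Countable := countable_rootsOfUnity.image _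
  -- Adding `t (X - 1)^r` to `a₀` keeps the congruence. At a root of unity `z ≠ 1` a zero occurs for
  -- at most one `t`, so countably many `t` are excluded. At `z = 1` the Bézout identity itself
  -- prevents a zero.
  obtain ⟨t, ht⟩ := (hcount.dense_compl ℝ).nonempty
  have hmul : ∀ a : Polynomial ℝ, maskSymbol r (a * (Polynomial.X - 1) ^ r) = a * Γ := by
    intro a
    have h1 := coe_maskSymbol hr (dvd_mul_left ((Polynomial.X - 1 : Polynomial ℝ) ^ r) a)
    have h2 := coe_maskSymbol hr (dvd_refl ((Polynomial.X - 1 : Polynomial ℝ) ^ r))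
    rw [Polynomial.coe_mul, mul_assoc, ← h2, ← Polynomial.coe_mul] at h1
    exact Polynomial.coe_injective ℝ h1
  refine ⟨a₀ + Polynomial.C t * (Polynomial.X - 1) ^ r, ?_, fun N z hN hz h => ?_⟩
  · rw [hmul]
    refine ⟨Polynomial.C t * Γ - w, ?_⟩
    linear_combination h0
  · have h2 : Polynomial.aeval z a₀ + t * (z - 1) ^ r = 0 := by
      simpa using h
    by_cases hz1 : z = 1
    · subst hz1
      have h3 := congrArg (Polynomial.aeval (1 : ℂ)) h0
      rw [sub_self, zero_pow (by omega), mul_zero, add_zero] at h2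
      simp [h2, zero_pow (show r ≠ 0 by omega)] at h3
    · refine ht ⟨z, ⟨N, hN, hz⟩, ?_⟩
      have hne : (z - 1) ^ r ≠ 0 := pow_ne_zero _ (sub_ne_zero.2 hz1)
      have : -(Polynomial.aeval z a₀) / (z - 1) ^ r = t := by
        rw [div_eq_iff hne]
        linear_combination -h2
      dsimp only
      rw [this, Complex.ofReal_re]

end Kernel

/-! ### Series of integer translates and polynomial reproduction -/

section Series

/-- The spline on the integer mesh with coefficients `c`. -/
noncomputable def splineSeries (r : ℕ) (β : Polynomial ℝ) (c : ℤ → ℝ) (x : ℝ) : ℝ :=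
  ∑' k : ℤ, c k * maskSpline r β (x - k)

variable {r : ℕ} {β : Polynomial ℝ}

theorem splineSeries_eq_sum (hr : 2 ≤ r) (hβ : (Polynomial.X - 1) ^ r ∣ β) (c : ℤ → ℝ) {x : ℝ}
    {F : Finset ℤ} (hF : ∀ k : ℤ, (k : ℝ) < x → x < k + β.natDegree → k ∈ F) :
    splineSeries r β c x = ∑ k ∈ F, c k * maskSpline r β (x - k) := by
  refine tsum_eq_sum fun k hk => ?_
  rcases le_or_gt x k with h | h
  · rw [maskSpline_of_nonpos hr β (by linarith), mul_zero]
  · rcases le_or_gt ((k : ℝ) + β.natDegree) x with h' | h'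
    · rw [maskSpline_of_natDegree_le hr hβ (by linarith), mul_zero]
    · exact absurd (hF k h h') hk

theorem mem_Icc_of_lt {n k : ℤ} {d : ℕ} {x : ℝ} (hx : x ∈ Set.Icc ((n : ℝ) - 1) (n + 1))
    (h1 : (k : ℝ) < x) (h2 : x < k + d) : k ∈ Finset.Icc (n - 1 - d) (n + 1) := by
  rw [Finset.mem_Icc]
  have h3 : ((n - 1 : ℤ) : ℝ) < ((k + d : ℤ) : ℝ) := by push_cast; linarith [hx.1]
  have h4 : (k : ℝ) < ((n + 1 : ℤ) : ℝ) := by push_cast; linarith [hx.2]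
  have h3' : n - 1 < k + d := by exact_mod_cast h3
  have h4' : k < n + 1 := by exact_mod_cast h4
  constructor <;> omega

theorem splineSeries_eq_sum_Icc (hr : 2 ≤ r) (hβ : (Polynomial.X - 1) ^ r ∣ β) (c : ℤ → ℝ)
    {n : ℤ} {x : ℝ} (hx : x ∈ Set.Icc ((n : ℝ) - 1) (n + 1)) :
    splineSeries r β c x
      = ∑ k ∈ Finset.Icc (n - 1 - β.natDegree) (n + 1), c k * maskSpline r β (x - k) :=
  splineSeries_eq_sum hr hβ c fun _ => mem_Icc_of_lt hx

theorem contDiff_splineSeries (hr : 2 ≤ r) (hβ : (Polynomial.X - 1) ^ r ∣ β) (c : ℤ → ℝ) :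
    ContDiff ℝ ((r - 2 : ℕ) : ℕ∞) (splineSeries r β c) := by
  rw [contDiff_iff_contDiffAt]
  intro x
  have hx : x ∈ Set.Ioo ((⌊x⌋ : ℝ) - 1) (⌊x⌋ + 1) :=
    ⟨by linarith [Int.floor_le x], Int.lt_floor_add_one x⟩
  have h : splineSeries r β c =ᶠ[nhds x] fun y =>
      ∑ k ∈ Finset.Icc (⌊x⌋ - 1 - β.natDegree) (⌊x⌋ + 1), c k * maskSpline r β (y - k) := by
    filter_upwards [isOpen_Ioo.mem_nhds hx] with y hy
    exact splineSeries_eq_sum_Icc hr hβ c (Set.Ioo_subset_Icc_self hy)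
  refine ContDiffAt.congr_of_eventuallyEq ?_ h
  refine ContDiffAt.sum fun k _ => contDiffAt_const.mul ?_
  exact ((contDiff_maskSpline hr β).comp (by fun_prop)).contDiffAt

/-- The local structure of a spline: crossing the node `n` adds a multiple of a truncated
power. -/
theorem exists_polynomial_splineSeries (hr : 2 ≤ r) (hβ : (Polynomial.X - 1) ^ r ∣ β)
    (c : ℤ → ℝ) (n : ℤ) : ∃ P ∈ Polynomial.degreeLT ℝ r,
      ∀ x ∈ Set.Icc ((n : ℝ) - 1) (n + 1), splineSeries r β c x
        = P.eval x + Polynomial.aeval (shiftEnd ℤ) β c n * truncPow r (x - n) := by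
  set F := Finset.Icc (n - 1 - β.natDegree) (n + 1) with hF
  set L := Finset.range (β.natDegree + 1) with hL
  -- On `[n - 1, n + 1]` knots `k + l < n` contribute full powers, which make up the polynomial.
  -- Knots beyond `n` contribute nothing, and those equal to `n` add up to the jump term.
  refine ⟨∑ k ∈ F, ∑ l ∈ L, if k + l < n then
    Polynomial.C (c k * β.coeff l) * (Polynomial.X - Polynomial.C ((k : ℝ) + l)) ^ (r - 1) else 0,
    ?_, fun x hx => ?_⟩
  · refine Submodule.sum_mem _ fun k _ => Submodule.sum_mem _ fun l _ => ?_
    split_ifs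
    · rw [← Polynomial.smul_eq_C_mul]
      refine Submodule.smul_mem _ _ (Polynomial.mem_degreeLT.2 ?_)
      rw [Polynomial.degree_pow, Polynomial.degree_X_sub_C, nsmul_one]
      exact_mod_cast (by omega : r - 1 < r)
    · exact Submodule.zero_mem _
  · have hjump : Polynomial.aeval (shiftEnd ℤ) β c n * truncPow r (x - n)
        = ∑ k ∈ F, ∑ l ∈ L, if k + l = n then c k * β.coeff l * truncPow r (x - n) else 0 := by
      rw [aeval_shiftEnd_apply (Nat.lt_succ_self _), Finset.sum_comm, Finset.sum_mul]
      refine Finset.sum_congr rfl fun l hl => ?_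
      have hl' : l < β.natDegree + 1 := Finset.mem_range.1 hl
      rw [Finset.sum_eq_single (n - l : ℤ)]
      · rw [if_pos (by ring)]; ring
      · intro k _ hk
        rw [if_neg (by omega)]
      · intro hk
        rw [hF, Finset.mem_Icc] at hk
        omega
    rw [hjump, splineSeries_eq_sum_Icc hr hβ c hx, Polynomial.eval_finsetSum,
      ← Finset.sum_add_distrib]
    refine Finset.sum_congr rfl fun k _ => ?_
    rw [maskSpline, Polynomial.eval_finsetSum, ← Finset.sum_add_distrib, Finset.mul_sum]
    refine Finset.sum_congr rfl fun l _ => ?_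
    rcases lt_trichotomy (k + l : ℤ) n with h | h | h
    · have h' : ((k + l : ℤ) : ℝ) ≤ ((n - 1 : ℤ) : ℝ) := by exact_mod_cast (by omega)
      push_cast at h'
      rw [if_pos h, if_neg h.ne, truncPow_of_nonneg (by linarith [hx.1])]
      simp only [Polynomial.eval_mul, Polynomial.eval_C, Polynomial.eval_pow, Polynomial.eval_sub,
        Polynomial.eval_X, add_zero]
      ring
    · have h' : x - k - l = x - n := by rw [← h]; push_cast; ring
      rw [if_neg h.not_lt, if_pos h, h']
      simp; ring
    · have h' : ((n + 1 : ℤ) : ℝ) ≤ ((k + l : ℤ) : ℝ) := by exact_mod_cast (by omega)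
      push_cast at h'
      rw [if_neg h.not_gt, if_neg h.ne', truncPow_of_nonpos hr (by linarith [hx.2])]
      simp

theorem splineSeries_add_int (c : ℤ → ℝ) (x : ℝ) (m : ℤ) :
    splineSeries r β c (x + m) = splineSeries r β (fun k => c (k + m)) x := by
  rw [splineSeries, ← (Equiv.addRight m).tsum_eq]
  refine tsum_congr fun k => ?_
  simp only [Equiv.coe_addRight]
  congr 2
  push_cast
  ring

theorem splineSeries_sum (hr : 2 ≤ r) (hβ : (Polynomial.X - 1) ^ r ∣ β) {ι : Type*}
    (s : Finset ι) (w : ι → ℝ) (c : ι → ℤ → ℝ) (x : ℝ) :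
    ∑ j ∈ s, w j * splineSeries r β (c j) x
      = splineSeries r β (fun k => ∑ j ∈ s, w j * c j k) x := by
  have hx : x ∈ Set.Icc ((⌊x⌋ : ℝ) - 1) (⌊x⌋ + 1) :=
    ⟨by linarith [Int.floor_le x], (Int.lt_floor_add_one x).le⟩
  simp only [splineSeries_eq_sum_Icc hr hβ _ hx, Finset.mul_sum, Finset.sum_mul]
  rw [Finset.sum_comm]
  simp only [mul_assoc]

theorem splineSeries_int (hr : 2 ≤ r) (hβ : (Polynomial.X - 1) ^ r ∣ β) (c : ℤ → ℝ) (n : ℤ) :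
    splineSeries r β c n = Polynomial.aeval (shiftEnd ℤ) (maskSymbol r β) c n := by
  have hdeg : (maskSymbol r β).natDegree < β.natDegree + 1 := by
    refine Nat.lt_succ_of_le (Polynomial.natDegree_sum_le_of_forall_le _ _ fun m hm => ?_)
    exact (Polynomial.natDegree_monomial_le _).trans
      (Nat.lt_succ_iff.1 (Finset.mem_range.1 hm))
  rw [aeval_shiftEnd_apply hdeg]
  have hco : ∀ m ∈ Finset.range (β.natDegree + 1),
      (maskSymbol r β).coeff m = maskSpline r β m := by
    intro m hm
    simp only [maskSymbol, Polynomial.finsetSum_coeff, Polynomial.coeff_monomial,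
      Finset.sum_ite_eq', if_pos hm]
  rw [splineSeries_eq_sum hr hβ c
    (F := (Finset.range (β.natDegree + 1)).image fun m : ℕ => n - (m : ℤ)),
    Finset.sum_image (by intro a _ b _ h; simpa using h)]
  · refine Finset.sum_congr rfl fun m hm => ?_
    rw [hco m hm, mul_comm]
    congr 2
    push_cast
    ring
  · intro k h1 h2
    have h1' : k < n := by exact_mod_cast h1
    have h2' : n < k + β.natDegree := by exact_mod_cast h2
    refine Finset.mem_image.2 ⟨(n - k).toNat, Finset.mem_range.2 (by omega), by omega⟩

/-- The spline series reproduces polynomials of degree less than `r`. -/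
theorem splineSeries_polynomial (hr : 2 ≤ r) (hβ : (Polynomial.X - 1) ^ r ∣ β)
    (hΓ : (Polynomial.X - 1) ^ r ∣ maskSymbol r β - 1) {q : Polynomial ℝ}
    (hq : q ∈ Polynomial.degreeLT ℝ r) (x : ℝ) :
    splineSeries r β (fun k => q.eval (k : ℝ)) x = q.eval x := by
  have h := exists_polynomial_splineSeries hr hβ fun k => q.eval (k : ℝ)
  -- All jumps vanish, so the series is a single polynomial; the condition on the symbol makes it
  -- agree with `q` at the integers.
  rw [aeval_shiftEnd_int_polynomial_eq_zero (by omega) hβ hq] at h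
  simp only [Pi.zero_apply, zero_mul, add_zero] at h
  choose P _ hP using h
  have hstep : ∀ n, P (n + 1) = P n := by
    intro n
    refine polynomial_eq_of_eqOn_Icc (α := n) (β := (n : ℝ) + 1) (by linarith) fun y hy => ?_
    rw [← hP n y ⟨by linarith [hy.1], hy.2⟩, ← hP (n + 1) y]
    constructor <;> push_cast <;> linarith [hy.1, hy.2]
  have hall : ∀ n, P n = P 0 := by
    intro n
    induction n using Int.induction_on with
    | zero => rfl
    | succ i ih => rw [hstep, ih]
    | pred i ih => rw [← ih, ← hstep, sub_add_cancel]
  have hval : ∀ y, splineSeries r β (fun k => q.eval (k : ℝ)) y = (P 0).eval y := by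
    intro y
    rw [← hall ⌊y⌋]
    exact hP _ _ ⟨by linarith [Int.floor_le y], (Int.lt_floor_add_one y).le⟩
  have hint : ∀ n : ℤ, (P 0).eval (n : ℝ) = q.eval (n : ℝ) := by
    intro n
    rw [← hval, splineSeries_int hr hβ]
    have h1 := aeval_shiftEnd_int_polynomial_eq_zero (by omega) hΓ hq
    rw [map_sub, map_one, LinearMap.sub_apply, Module.End.one_apply, sub_eq_zero] at h1
    exact congrFun h1 n
  have hPq : P 0 = q := by
    refine Polynomial.eq_of_infinite_eval_eq _ _ ((Set.infinite_range_of_injective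
      (Int.cast_injective (α := ℝ))).mono ?_)
    rintro _ ⟨n, rfl⟩
    exact hint n
  rw [hval, hPq]

/-- To the left of `n` the local polynomial must vanish; at `n + 1` only the jump coefficient is
left. -/
theorem aeval_shiftEnd_eq_zero_of_splineSeries (hr : 2 ≤ r) (hβ : (Polynomial.X - 1) ^ r ∣ β)
    {c : ℤ → ℝ} (h : ∀ x, splineSeries r β c x = 0) :
    Polynomial.aeval (shiftEnd ℤ) β c = 0 := by
  funext n
  obtain ⟨P, -, hP⟩ := exists_polynomial_splineSeries hr hβ c n
  have hP0 : P = 0 := by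
    refine polynomial_eq_zero_of_eqOn_Icc (α := (n : ℝ) - 1) (β := n) (by linarith)
      fun x hx => ?_
    have := hP x ⟨hx.1, by linarith [hx.2]⟩
    rw [h, truncPow_of_nonpos hr (by linarith [hx.2]), mul_zero, add_zero] at this
    exact this.symm
  have h1 := hP (n + 1) ⟨by linarith, le_rfl⟩
  rw [h, hP0, add_sub_cancel_left, truncPow_of_nonneg zero_le_one] at h1
  simpa using h1.symm

end Series

/-! ### The periodized kernels form a basis of the spline space -/

section Basis

variable {r N : ℕ} {β : Polynomial ℝ}

/-- The indicator of the residue class of `j + 1` modulo `N`. -/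
def residueIndicator {N : ℕ} (j : Fin N) (k : ℤ) : ℝ :=
  if (N : ℤ) ∣ k - ((j : ℤ) + 1) then 1 else 0

theorem residueIndicator_add (j : Fin N) (k : ℤ) :
    residueIndicator j (k + N) = residueIndicator j k := by
  have : (N : ℤ) ∣ k + N - ((j : ℤ) + 1) ↔ (N : ℤ) ∣ k - ((j : ℤ) + 1) := by
    rw [add_sub_right_comm]
    exact dvd_add_self_right
  simp only [residueIndicator, this]

theorem sum_residueIndicator (hN : 1 ≤ N) {e : ℤ → ℝ} (he : Function.Periodic e (N : ℤ))
    (k : ℤ) : ∑ j : Fin N, e ((j : ℤ) + 1) * residueIndicator j k = e k := by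
  have hN0 : (0 : ℤ) < N := by exact_mod_cast hN
  have h1 := Int.emod_nonneg (k - 1) hN0.ne'
  have h2 := Int.emod_lt_of_pos (k - 1) hN0
  have h3 := Int.emod_add_mul_ediv (k - 1) N
  set i : Fin N := ⟨((k - 1) % N).toNat, by omega⟩ with hi
  have hi' : (i : ℤ) = (k - 1) % N := by
    rw [hi]; exact Int.toNat_of_nonneg h1
  rw [Finset.sum_eq_single i]
  · have hd : (N : ℤ) ∣ k - ((i : ℤ) + 1) := ⟨(k - 1) / N, by rw [hi']; linarith⟩
    rw [residueIndicator, if_pos hd, mul_one]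
    obtain ⟨m, hm⟩ := hd
    have hk : k = (i : ℤ) + 1 + m * N := by linarith
    rw [hk]
    exact (he.int_mul m _).symm
  · intro j _ hj
    rw [residueIndicator, if_neg, mul_zero]
    intro hd
    apply hj
    have hd' : (N : ℤ) ∣ (k - 1) - j := by
      convert hd using 1; ring
    have h4 : (k - 1) % N = (j : ℤ) % N :=
      Int.emod_eq_emod_iff_emod_sub_eq_zero.2 (Int.emod_eq_zero_of_dvd hd')
    rw [Int.emod_eq_of_lt (a := (j : ℤ)) (by positivity) (by exact_mod_cast j.2)] at h4
    ext
    have : (i : ℤ) = j := by rw [hi', h4]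
    exact_mod_cast this.symm
  · intro h; exact absurd (Finset.mem_univ _) h

/-- The basis functions of the quasiinterpolant on the mesh with `N` cells. -/
noncomputable def maskBasis (r : ℕ) (β : Polynomial ℝ) (N : ℕ) (j : Fin N) (x : ℝ) : ℝ :=
  splineSeries r β (residueIndicator j) (N * x)

theorem scale_mem_degreeLT {r : ℕ} (hr : 0 < r) {P : Polynomial ℝ}
    (hP : P ∈ Polynomial.degreeLT ℝ r) (s : ℝ) :
    P.comp (Polynomial.C s * Polynomial.X) ∈ Polynomial.degreeLT ℝ r := by
  rw [Polynomial.mem_degreeLT]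
  refine Polynomial.degree_le_natDegree.trans_lt ?_
  have h1 := natDegree_lt_of_mem_degreeLT hr hP
  have h2 : (P.comp (Polynomial.C s * Polynomial.X)).natDegree ≤ P.natDegree := by
    refine Polynomial.natDegree_comp_le.trans ?_
    calc _ ≤ P.natDegree * 1 := Nat.mul_le_mul_left _
          ((Polynomial.natDegree_C_mul_le s _).trans Polynomial.natDegree_X_le)
      _ = _ := mul_one _
  exact_mod_cast h2.trans_lt h1

theorem maskBasis_mem (hr : 2 ≤ r) (hβ : (Polynomial.X - 1) ^ r ∣ β) (hN : 1 ≤ N) (j : Fin N) :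
    maskBasis r β N j ∈ splineSpace r N := by
  have hN0 : (0 : ℝ) < N := by exact_mod_cast hN
  refine ⟨fun x => ?_, (contDiff_splineSeries hr hβ _).comp (by fun_prop), fun i _ => ?_⟩
  · have h1 : (N : ℝ) * (x + 1) = N * x + ((N : ℤ) : ℝ) := by push_cast; ring
    rw [maskBasis, h1, splineSeries_add_int, maskBasis]
    simp only [residueIndicator_add]
  -- Taking the node at the right end `i + 1` makes the truncated power vanish on the cell.
  · obtain ⟨P, hP, hPx⟩ := exists_polynomial_splineSeries hr hβ (residueIndicator j) (i + 1)
    refine ⟨_, scale_mem_degreeLT (by omega) hP N, fun x hx => ?_⟩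
    have h1 : (i : ℝ) ≤ N * x := by
      have := hx.1
      rwa [div_le_iff₀ hN0, mul_comm] at this
    have h2 : N * x ≤ (i : ℝ) + 1 := by
      have := hx.2
      rwa [le_div_iff₀ hN0, mul_comm] at this
    rw [maskBasis, hPx _ (by constructor <;> push_cast <;> linarith),
      truncPow_of_nonpos hr (by push_cast; linarith)]
    simp

theorem sum_mul_maskBasis (hr : 2 ≤ r) (hβ : (Polynomial.X - 1) ^ r ∣ β) (hN : 1 ≤ N)
    {e : ℤ → ℝ} (he : Function.Periodic e (N : ℤ)) (x : ℝ) :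
    ∑ j : Fin N, e ((j : ℤ) + 1) * maskBasis r β N j x = splineSeries r β e (N * x) := by
  simp only [maskBasis]
  rw [splineSeries_sum hr hβ Finset.univ (fun j : Fin N => e ((j : ℤ) + 1)) residueIndicator]
  simp only [sum_residueIndicator hN he]

/-- A vanishing combination has a periodic coefficient sequence annihilated by the mask, hence a
constant one. Constants are reproduced, so that constant is zero. -/
theorem linearIndependent_maskBasis (hr : 2 ≤ r) {a : Polynomial ℝ}
    (ha : ∀ z : ℂ, z ^ N = 1 → Polynomial.aeval z a ≠ 0)
    (hΓ : (Polynomial.X - 1) ^ r ∣ maskSymbol r (a * (Polynomial.X - 1) ^ r) - 1) (hN : 1 ≤ N) :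
    LinearIndependent ℝ (maskBasis r (a * (Polynomial.X - 1) ^ r) N) := by
  set β := a * (Polynomial.X - 1) ^ r with hβdef
  have hβ : (Polynomial.X - 1) ^ r ∣ β := dvd_mul_left _ _
  have hN0 : (N : ℝ) ≠ 0 := by positivity
  rw [Fintype.linearIndependent_iff]
  intro w hw i
  set e : ℤ → ℝ := fun k => ∑ j : Fin N, w j * residueIndicator j k with he
  have hper : Function.Periodic e (N : ℤ) := fun k => by
    simp only [he, residueIndicator_add]
  have hzero : ∀ x, splineSeries r β e x = 0 := by
    intro x
    have h1 := congrFun hw (x / N)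
    simp only [Finset.sum_apply, Pi.smul_apply, smul_eq_mul, maskBasis, Pi.zero_apply,
      mul_div_cancel₀ x hN0] at h1
    rw [splineSeries_sum hr hβ] at h1
    exact h1
  have hconst := periodic_eq_of_aeval_shiftEnd_eq_zero (by omega) hN ha
    (fun k => hper.sub_eq k) (aeval_shiftEnd_eq_zero_of_splineSeries hr hβ hzero)
  have he0 : e 0 = 0 := by
    have h1 := splineSeries_polynomial hr hβ hΓ (q := Polynomial.C (e 0)) (by
      rw [Polynomial.mem_degreeLT]
      exact Polynomial.degree_C_le.trans_lt (by exact_mod_cast (by omega : 0 < r))) 0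
    simp only [Polynomial.eval_C] at h1
    rw [← h1, show (fun _ : ℤ => e 0) = e from funext fun k => (hconst k).symm, hzero]
  have hei : e ((i : ℤ) + 1) = w i := by
    simp only [he]
    rw [Finset.sum_eq_single i]
    · simp [residueIndicator]
    · intro j _ hj
      rw [residueIndicator, if_neg, mul_zero]
      rintro ⟨m, hm⟩
      apply hj
      have hi2 := i.2
      have hj2 := j.2
      have hm0 : m = 0 := by
        by_contra hm0
        rcases lt_or_gt_of_ne hm0 with h | h
        · have : (N : ℤ) * m ≤ N * (-1) := by
            apply mul_le_mul_of_nonneg_left <;> omega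
          omega
        · have : (N : ℤ) * 1 ≤ N * m := by
            apply mul_le_mul_of_nonneg_left <;> omega
          omega
      rw [hm0] at hm
      ext
      omega
    · intro h; exact absurd (Finset.mem_univ _) h
  rw [← hei, hconst, he0]

theorem span_maskBasis (hr : 3 ≤ r) {a : Polynomial ℝ}
    (ha : ∀ z : ℂ, z ^ N = 1 → Polynomial.aeval z a ≠ 0)
    (hΓ : (Polynomial.X - 1) ^ r ∣ maskSymbol r (a * (Polynomial.X - 1) ^ r) - 1) (hN : 1 ≤ N) :
    Submodule.span ℝ (Set.range (maskBasis r (a * (Polynomial.X - 1) ^ r) N))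
      = splineSpace r N := by
  have := finite_splineSpace hr hN
  refine Submodule.eq_of_le_of_finrank_le ?_ ?_
  · rw [Submodule.span_le]
    rintro _ ⟨j, rfl⟩
    exact maskBasis_mem (by omega) (dvd_mul_left _ _) hN j
  · rw [finrank_span_eq_card (linearIndependent_maskBasis (by omega) ha hΓ hN), Fintype.card_fin]
    exact finrank_splineSpace_le hr hN

theorem maskBasis_support (hr : 2 ≤ r) (hβ : (Polynomial.X - 1) ^ r ∣ β) (hN : 1 ≤ N)
    (j : Fin N) {x : ℝ} (hx : maskBasis r β N j x ≠ 0) :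
    ∃ m : ℤ, |x - m - ((j : ℝ) + 1) / N| ≤ β.natDegree * (1 / (N : ℝ)) := by
  have hN0 : (0 : ℝ) < N := by exact_mod_cast hN
  have h1 : ∃ k : ℤ, residueIndicator j k * maskSpline r β (N * x - k) ≠ 0 := by
    by_contra! h
    exact hx (by rw [maskBasis, splineSeries]; simp [h])
  obtain ⟨k, hk⟩ := h1
  have hk1 := left_ne_zero_of_mul hk
  have hk2 := right_ne_zero_of_mul hk
  rw [residueIndicator, ite_ne_right_iff] at hk1
  obtain ⟨⟨m, hm⟩, -⟩ := hk1
  have hpos : 0 < N * x - k := by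
    by_contra h
    exact hk2 (maskSpline_of_nonpos hr β (not_lt.1 h))
  have hlt : N * x - k < β.natDegree := by
    by_contra h
    exact hk2 (maskSpline_of_natDegree_le hr hβ (not_lt.1 h))
  have hm' : (k : ℝ) = N * m + ((j : ℝ) + 1) := by
    have : k = N * m + ((j : ℤ) + 1) := by linarith
    rw [this]; push_cast; ring
  refine ⟨m, ?_⟩
  have e : x - m - ((j : ℝ) + 1) / N = (N * x - k) * (1 / N) := by
    rw [hm']; field_simp; ring
  rw [e, abs_of_nonneg (by positivity)]
  gcongr

end Basis

/-! ### Optimal order of the constructed quasiinterpolants -/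

section Order

/-- Integrals of a periodic function over overlapping groups of `R + 1` cells. -/
theorem sum_integral_extended_cells {N : ℕ} (hN : 1 ≤ N) (R : ℕ) {g : ℝ → ℝ} (hg : Continuous g)
    (hgp : Function.Periodic g 1) :
    ∑ i ∈ Finset.range N, ∫ t in (((i : ℝ) - R) / N)..(((i : ℝ) + 1) / N), g t
      = (R + 1) * ∫ t in (0 : ℝ)..1, g t := by
  have h1 : ∀ i : ℕ, ∫ t in (((i : ℝ) - R) / N)..(((i : ℝ) + 1) / N), g t
      = ∑ l ∈ Finset.range (R + 1),
        ∫ t in ((i : ℝ) / N)..(((i : ℝ) + 1) / N), g (t + ((l : ℝ) - R) / N) := by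
    intro i
    have h2 := intervalIntegral.sum_integral_adjacent_intervals (f := g) (μ := volume)
      (n := R + 1) (a := fun l : ℕ => ((i : ℝ) - R + l) / N) fun k _ => hg.intervalIntegrable _ _
    have e0 : ((i : ℝ) - R + ((0 : ℕ) : ℝ)) / N = ((i : ℝ) - R) / N := by simp
    have e1 : ((i : ℝ) - R + ((R + 1 : ℕ) : ℝ)) / N = ((i : ℝ) + 1) / N := by push_cast; ring
    rw [e0, e1] at h2
    rw [← h2]
    refine Finset.sum_congr rfl fun l _ => ?_
    rw [intervalIntegral.integral_comp_add_right]
    congr 1 <;> push_cast <;> ring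
  simp only [h1]
  rw [Finset.sum_comm]
  have h3 : ∀ l ∈ Finset.range (R + 1), ∑ i ∈ Finset.range N,
      ∫ t in ((i : ℝ) / N)..(((i : ℝ) + 1) / N), g (t + ((l : ℝ) - R) / N)
        = ∫ t in (0 : ℝ)..1, g t := by
    intro l _
    rw [sum_integral_cells hN (f := fun t => g (t + ((l : ℝ) - R) / N)) (by fun_prop),
      intervalIntegral.integral_comp_add_right, zero_add, add_comm (1 : ℝ),
      hgp.intervalIntegral_add_eq _ 0, zero_add]
  rw [Finset.sum_congr rfl h3, Finset.sum_const, Finset.card_range, nsmul_eq_mul]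
  push_cast
  ring

variable {r N : ℕ} {β : Polynomial ℝ}

theorem quasiInterp_maskBasis (hr : 2 ≤ r) (hβ : (Polynomial.X - 1) ^ r ∣ β) (hN : 1 ≤ N)
    {v : ℝ → ℝ} (hv : Function.Periodic v 1) (x : ℝ) :
    quasiInterp (maskBasis r β N) v x = splineSeries r β (fun k => v (k / N)) (N * x) := by
  have hN0 : (N : ℝ) ≠ 0 := by positivity
  have hper : Function.Periodic (fun k : ℤ => v (k / N)) (N : ℤ) := fun k => by
    have : ((k + (N : ℤ) : ℤ) : ℝ) / N = k / N + 1 := by push_cast; field_simp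
    simp only [this, hv _]
  rw [← sum_mul_maskBasis hr hβ hN hper]
  simp [quasiInterp]

/-- The error on one cell, by reproduction of the Taylor polynomial. -/
theorem sq_maskBasis_error_le (hr : 2 ≤ r) (hβ : (Polynomial.X - 1) ^ r ∣ β)
    (hΓ : (Polynomial.X - 1) ^ r ∣ maskSymbol r β - 1) (hN : 1 ≤ N) {B : ℝ}
    (hB : ∀ x, |maskSpline r β x| ≤ B) {v : ℝ → ℝ} (hvp : Function.Periodic v 1)
    (hv : ContDiff ℝ ∞ v) (i : ℕ) {x : ℝ} (hx : x ∈ Set.Icc ((i : ℝ) / N) (((i : ℝ) + 1) / N)) :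
    (quasiInterp (maskBasis r β N) v x - v x) ^ 2 ≤
      ((β.natDegree + 1) * B + 1) ^ 2 * (((β.natDegree : ℝ) + 1) * (1 / N)) ^ (2 * (r - 1) + 1) *
        ∫ t in (((i : ℝ) - β.natDegree) / N)..(((i : ℝ) + 1) / N), iteratedDeriv r v t ^ 2 := by
  set R := β.natDegree with hR
  have hN0 : (0 : ℝ) < N := by exact_mod_cast hN
  have hB0 : 0 ≤ B := (abs_nonneg _).trans (hB 0)
  -- Expand at the left node. On this cell only the nodes `(i - R) / N, …, i / N` enter, so the
  -- remainder is needed on `R + 1` cells only.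
  obtain ⟨p, hpd, hp⟩ := exists_polynomial_iteratedDeriv_eq (fun k => iteratedDeriv k v (i / N))
    ((i : ℝ) / N) r
  have hps : ContDiff ℝ ∞ fun x => p.eval x := contDiff_polynomial_eval p
  set w : ℝ → ℝ := fun y => v y - p.eval y with hw
  have hws : ContDiff ℝ ∞ w := hv.sub hps
  have hwr : ∀ t, iteratedDeriv r w t = iteratedDeriv r v t := fun t => by
    rw [hw, iteratedDeriv_sub_of_smooth hv hps, iteratedDeriv_polynomial_eval]
    simp [iterate_derivative_eq_zero_of_mem_degreeLT hpd le_rfl]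
  set J := ∫ t in (((i : ℝ) - R) / N)..(((i : ℝ) + 1) / N), iteratedDeriv r v t ^ 2 with hJ
  set M := (((R : ℝ) + 1) * (1 / N)) ^ (2 * (r - 1) + 1) * J with hM
  have hαβ : ((i : ℝ) - R) / N ≤ ((i : ℝ) + 1) / N := by
    gcongr
    have : (0 : ℝ) ≤ R := by positivity
    linarith
  have hiR : ((i : ℝ) - R) / N ≤ (i : ℝ) / N := by
    gcongr
    have : (0 : ℝ) ≤ R := by positivity
    linarith
  have hM0 : 0 ≤ M := mul_nonneg (by positivity)
    (intervalIntegral.integral_nonneg hαβ fun _ _ => sq_nonneg _)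
  have hwM : ∀ y ∈ Set.Icc (((i : ℝ) - R) / N) (((i : ℝ) + 1) / N), |w y| ≤ √M := by
    intro y hy
    have h := sq_iteratedDeriv_le_of_vanishing hws (r := r) (a := (i : ℝ) / N)
      ⟨hiR, (cell_lt hN i).le⟩ (fun k hk => by
        rw [hw, iteratedDeriv_sub_of_smooth hv hps, hp k hk, sub_self]) (k := 0) (by omega) hy
    have e : ((i : ℝ) + 1) / N - ((i : ℝ) - R) / N = ((R : ℝ) + 1) * (1 / N) := by ring
    simp only [iteratedDeriv_zero, hwr, e, Nat.sub_zero] at h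
    exact Real.abs_le_sqrt h
  have hNx1 : (i : ℝ) ≤ N * x := by
    have := hx.1
    rwa [div_le_iff₀ hN0, mul_comm] at this
  have hNx2 : N * x ≤ (i : ℝ) + 1 := by
    have := hx.2
    rwa [le_div_iff₀ hN0, mul_comm] at this
  have hF : ∀ k : ℤ, (k : ℝ) < N * x → N * x < k + β.natDegree →
      k ∈ Finset.Icc ((i : ℤ) - R) i := by
    intro k h1 h2
    have h3 : (k : ℝ) < ((i + 1 : ℤ) : ℝ) := by push_cast; linarith
    have h4 : ((i : ℤ) : ℝ) < ((k + R : ℤ) : ℝ) := by push_cast; linarith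
    have h3' : k < i + 1 := by exact_mod_cast h3
    have h4' : (i : ℤ) < k + R := by exact_mod_cast h4
    rw [Finset.mem_Icc]
    constructor <;> omega
  have hrep : splineSeries r β (fun k : ℤ => p.eval ((k : ℝ) / N)) (N * x) = p.eval x := by
    have h := splineSeries_polynomial hr hβ hΓ
      (scale_mem_degreeLT (by omega) hpd (1 / (N : ℝ))) (N * x)
    have e1 : (1 / (N : ℝ)) * (N * x) = x := by field_simp
    simp only [Polynomial.eval_comp, Polynomial.eval_mul, Polynomial.eval_C, Polynomial.eval_X,
      e1] at h
    simpa only [one_div_mul_eq_div] using h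
  have hsum : quasiInterp (maskBasis r β N) v x - v x
      = (∑ k ∈ Finset.Icc ((i : ℤ) - R) i, w (k / N) * maskSpline r β (N * x - k)) - w x := by
    rw [quasiInterp_maskBasis hr hβ hN hvp, splineSeries_eq_sum hr hβ _ hF]
    rw [splineSeries_eq_sum hr hβ _ hF] at hrep
    simp only [hw, sub_mul, Finset.sum_sub_distrib, hrep]
    ring
  have hterm : ∀ k ∈ Finset.Icc ((i : ℤ) - R) i,
      |w (k / N) * maskSpline r β (N * x - k)| ≤ √M * B := by
    intro k hk
    rw [Finset.mem_Icc] at hk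
    have h1 : (i : ℝ) - R ≤ k := by exact_mod_cast hk.1
    have h2 : (k : ℝ) ≤ i := by exact_mod_cast hk.2
    rw [abs_mul]
    refine mul_le_mul (hwM _ ⟨?_, ?_⟩) (hB _) (abs_nonneg _) (Real.sqrt_nonneg _)
    · gcongr
    · gcongr; linarith
  have habs : |quasiInterp (maskBasis r β N) v x - v x| ≤ ((R + 1) * B + 1) * √M := by
    rw [hsum]
    refine (abs_sub _ _).trans ?_
    have h1 := (Finset.abs_sum_le_sum_abs _ _).trans (Finset.sum_le_sum hterm)
    rw [Finset.sum_const, Int.card_Icc, nsmul_eq_mul] at h1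
    have h2 : (((i : ℤ) + 1 - (i - R)).toNat : ℝ) = R + 1 := by
      have : ((i : ℤ) + 1 - (i - R)).toNat = R + 1 := by omega
      rw [this]; push_cast; ring
    rw [h2] at h1
    have h3 := hwM x ⟨hiR.trans hx.1, hx.2⟩
    linarith
  calc _ = |quasiInterp (maskBasis r β N) v x - v x| ^ 2 := (sq_abs _).symm
    _ ≤ (((R + 1) * B + 1) * √M) ^ 2 := by gcongr
    _ = _ := by rw [mul_pow, Real.sq_sqrt hM0, hM]; ring

/-- Integrating the pointwise bound over a cell raises `h^(2r-1)` to `h^(2r)`. The extended cells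
cover the period `R + 1` times, which likewise completes `(R + 1)^(2r)`. -/
theorem exists_maskBasis_error_bound (hr : 3 ≤ r) (hβ : (Polynomial.X - 1) ^ r ∣ β)
    (hΓ : (Polynomial.X - 1) ^ r ∣ maskSymbol r β - 1) : ∃ C : ℝ, ∀ N, 1 ≤ N →
    ∀ v : ℝ → ℝ, Function.Periodic v 1 → ContDiff ℝ ∞ v →
      eLpNorm (quasiInterp (maskBasis r β N) v - v) 2 perMeasure ≤
        ENNReal.ofReal (C * (1 / (N : ℝ)) ^ r) * eLpNorm (iteratedDeriv r v) 2 perMeasure := by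
  obtain ⟨B, hB0, hB⟩ := exists_bound_maskSpline (by omega : 2 ≤ r) hβ
  set R := β.natDegree with hR
  refine ⟨((R + 1) * B + 1) * (R + 1) ^ r, fun N hN v hvp hv => ?_⟩
  have hN0 : (0 : ℝ) < N := by exact_mod_cast hN
  set Q := quasiInterp (maskBasis r β N) v with hQ
  have hQc : Continuous Q :=
    continuous_spline (quasiInterp_mem (fun j => maskBasis_mem (by omega) hβ hN j) v)
  have hec : Continuous (Q - v) := hQc.sub hv.continuous
  have hrc := continuous_iteratedDeriv_of_smooth hv r
  set g : ℝ → ℝ := fun t => iteratedDeriv r v t ^ 2 with hg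
  set D : ℝ := ((R + 1) * B + 1) ^ 2 * (((R : ℝ) + 1) * (1 / N)) ^ (2 * (r - 1) + 1) with hD
  have hsq : ∫ x in (0 : ℝ)..1, (Q - v) x ^ 2 ≤
      (((R + 1) * B + 1) * (R + 1) ^ r * (1 / (N : ℝ)) ^ r) ^ 2 * ∫ t in (0 : ℝ)..1, g t := by
    rw [← sum_integral_cells hN (f := fun x => (Q - v) x ^ 2) (hec.pow 2)]
    calc _ ≤ ∑ i ∈ Finset.range N,
          (1 / (N : ℝ)) * (D * ∫ t in (((i : ℝ) - R) / N)..(((i : ℝ) + 1) / N), g t) := by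
          refine Finset.sum_le_sum fun i _ => ?_
          refine (intervalIntegral.integral_mono_on (cell_lt hN i).le
            ((hec.pow 2).intervalIntegrable _ _) intervalIntegrable_const fun x hx =>
              sq_maskBasis_error_le (by omega) hβ hΓ hN hB hvp hv i hx).trans (le_of_eq ?_)
          rw [intervalIntegral.integral_const, smul_eq_mul]
          congr 1
          ring
      _ = (1 / (N : ℝ)) * D * ((R + 1) * ∫ t in (0 : ℝ)..1, g t) := by
          rw [← sum_integral_extended_cells hN R (g := g) (hrc.pow 2) fun x => by
            simp only [hg, periodic_iteratedDeriv hvp r x], ← Finset.mul_sum, ← Finset.mul_sum]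
          ring
      _ = _ := by
          obtain ⟨s, rfl⟩ : ∃ s, r = s + 1 := ⟨r - 1, by omega⟩
          rw [hD, Nat.add_sub_cancel, mul_pow ((R : ℝ) + 1)]
          ring
  rw [eLpNorm_two_perMeasure hec, eLpNorm_two_perMeasure hrc, ← ENNReal.ofReal_mul (by positivity)]
  refine ENNReal.ofReal_le_ofReal ?_
  rw [Real.sqrt_le_left (by positivity), mul_pow, Real.sq_sqrt]
  · exact hsq
  · exact intervalIntegral.integral_nonneg zero_le_one fun _ _ => sq_nonneg _

end Order

theorem exists_isQuasiInterpBasis {r : ℕ} (hr : 3 ≤ r) :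
    ∃ φ : ∀ N : ℕ, Fin N → ℝ → ℝ, IsQuasiInterpBasis r φ := by
  obtain ⟨a, hΓ, ha⟩ := exists_mask (by omega : 2 ≤ r)
  have hβ : (Polynomial.X - 1) ^ r ∣ a * (Polynomial.X - 1 : Polynomial ℝ) ^ r := dvd_mul_left _ _
  refine ⟨fun N => maskBasis r (a * (Polynomial.X - 1) ^ r) N, ?_, ?_, ?_, ?_⟩
  · exact fun N hN => linearIndependent_maskBasis (by omega) (fun z hz => ha N z hN hz) hΓ hN
  · exact fun N hN => span_maskBasis hr (fun z hz => ha N z hN hz) hΓ hN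
  · exact ⟨_, fun N hN j => ⟨_, fun x hx => maskBasis_support (by omega) hβ hN j hx⟩⟩
  · exact exists_maskBasis_error_bound hr hβ hΓ

theorem lemma2p1 (r : ℕ) (hr : 3 ≤ r) :
    (∃ φ : ∀ N : ℕ, Fin N → ℝ → ℝ, IsQuasiInterpBasis r φ) ∧
    ∀ φ : ∀ N : ℕ, Fin N → ℝ → ℝ, IsQuasiInterpBasis r φ →
      (∃ C : ℝ, ∀ v : ℝ → ℝ, MemHperWinf r v → ∀ N : ℕ, 1 ≤ N → ∀ j ≤ 2,
        perHNorm j (quasiInterp (φ N) v - v) ≤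
          ENNReal.ofReal (C * (1 / (N : ℝ)) ^ (r - j)) * perHNorm r v ∧
        perWNorm j (quasiInterp (φ N) v - v) ≤
          ENNReal.ofReal (C * (1 / (N : ℝ)) ^ ((r : ℝ) - (j : ℝ) - 1 / 2)) * perWNorm r v) ∧
      ∀ v : ℝ → ℝ, MemHperWinf r v →
        (∃ C : ℝ, ∀ N : ℕ, 1 ≤ N → ∀ j ≤ 2,
          perHNorm j (quasiInterp (φ N) v) ≤ ENNReal.ofReal C ∧
          perWNorm j (quasiInterp (φ N) v) ≤ ENNReal.ofReal C) ∧
        (∀ c₀ : ℝ, 0 < c₀ → (∀ x ∈ Set.Icc (0 : ℝ) 1, c₀ ≤ v x) →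
          ∃ h₀ : ℝ, 0 < h₀ ∧ ∀ N : ℕ, 1 ≤ N → 1 / (N : ℝ) ≤ h₀ →
            ∀ x ∈ Set.Icc (0 : ℝ) 1, c₀ / 2 ≤ quasiInterp (φ N) v x) := by
  refine ⟨exists_isQuasiInterpBasis hr, fun φ h => ?_⟩
  obtain ⟨K, hK, hE⟩ := h.exists_errorBound hr
  refine ⟨⟨2 * K, fun v hv N hN j hj => ⟨perHNorm_error_le hr h hK hE hv hN hj,
    perWNorm_error_le hr h hK hE hv hN hj⟩⟩, fun v hv =>
    ⟨quasiInterp_norms_bounded hr h hK hE hv, fun c₀ hc₀ hvc =>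
      quasiInterp_lower_bound hr h hK hE hv hc₀ hvc⟩⟩
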